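/- \textbf{Theorem (lock-in probability).} Let $f:\mathbb{R}^d\times\mathbb{R}^k\to\mathbb{R}^d$ be measurable and let $\Pi_\theta(y;dx)$, $\theta\in\mathbb{R}^d$, be transition probabilities on $\mathbb{R}^k$, jointly measurable in $(\theta,y)$. Assume: (1) $\|f(\theta,y)\|\le K(1+\|\theta\|)$ for all $\theta,y$. (2) For every $\theta$, $\Pi_\theta$ has a unique invariant probability measure $\Gamma_\theta$, and $h(\theta)=\int f(\theta,y)\,\Gamma_\theta(dy)$ is Lipschitz in $\theta$. (3) For every $\theta$ there is a measurable, $\Pi_\theta(y;\cdot)$-integrable (for every $y$) solution $v_\theta:\mathbb{R}^k\to\mathbb{R}^d$ of the Poisson equation $v_\theta(y)-\int v_\theta(z)\,\Pi_\theta(y;dz)=f(\theta,y)-h(\theta)$, $y\in\mathbb{R}^k$. For every $R>0$ there is $C_R>0$ such that, for all $\|\theta\|,\|\theta'\|\le R$ and all $y$, $\|v_\theta(y)\|\le C_R(1+\|y\|)$ and $\|v_\theta(y)-v_{\theta'}(y)\|\le C_R\|\theta-\theta'\|(1+\|y\|)$. (4) $G\subset\mathbb{R}^d$ is open and $V:G\to[0,\infty)$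 is differentiable with $\langle\nabla V,h\rangle\le 0$ on $G$; the set $H=\{\theta\in G: V(\theta)=0\}$ equals $\{\theta\in G:\langle\nabla V(\theta),h(\theta)\rangle=0\}$ and is compact. $B$ is an open set with compact closure, $H\subset B\subset\bar B\subset G$, and $\bar B$ is contained in the domain of attraction of $H$ for $\dot\theta=h(\theta)$: every solution starting in $\bar B$ converges to $H$ as $t\to\infty$. For a set $A$ and $r>0$ let $N_r(A)=\{y:\|y-x\|<r\text{ for some }x\in A\}$, and let $0<\epsilon_1<\epsilon$ be such that $N_\epsilon(H)\subset B$. Let $\bar C,K'$ be constants. Then there are constants $\hat K,\hat C>0$, depending only on the objects named so far, such that the following holds for every $\delta_B>0$ with $N_{\delta_B}(N_{\epsilon_1}(H))\subset N_\epsilon(H)$, every non-increasing sequence $a(n)>0$, $n\ge0$, with $\sum_n a(n)=\infty$ and $\sum_n a(n)^2<\infty$, and every process of the following kind. On a probability space with a filtration $(\mathcal F_n)_{n\ge0}$, let $\theta_n\in\mathbb{R}^d$ and $Y_n\in\mathbb{R}^k$ be adapted, let $M_{n+1}\in\mathbb{R}^d$ be integrable and $\mathcal F_{n+1}$-measurable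 with $E[M_{n+1}\mid\mathcal F_n]=0$ and $\|M_{n+1}\|\le K'(1+\|\theta_n\|)$ a.s., let $P[Y_{n+1}\in A\mid\mathcal F_n]=\Pi_{\theta_n}(Y_n;A)$ a.s. for all Borel sets $A$, and let $$\theta_{n+1}=\theta_n+a(n)\,[f(\theta_n,Y_n)+M_{n+1}],\qquad n\ge 0;$$ moreover, for all large $n$, $\|Y_n\|\le\bar C$ a.s. Let $\bar\theta$ be the continuous piecewise linear function on $[0,\infty)$ with $\bar\theta\bigl(\sum_{m<n}a(m)\bigr)=\theta_n$, linear between these instants, and let $s(n)=\sum_{m\ge n}a(m)^2$. Then for all sufficiently large $n_0$ with $P(\theta_{n_0}\in B)>0$, $$P\bigl(\bar\theta(t)\to H\text{ as }t\to\infty\,\big|\,\theta_{n_0}\in B\bigr)\ \ge\ 1-2d\,e^{-\hat K\delta_B^2/(d\,s(n_0))}-2d\,e^{-\hat C\delta_B^2/(d\,s(n_0))}.$$ -/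

import Mathlib

open MeasureTheory ProbabilityTheory Filter Topology Set
open scoped NNReal ENNReal

namespace LockIn

/-- The Euclidean space `ℝ^n`. -/
abbrev E (n : ℕ) := EuclideanSpace ℝ (Fin n)

/-- The step sizes: positive, non-increasing, with `∑ a(n) = ∞` and `∑ a(n)² < ∞`. -/
structure IsStepSize (a : ℕ → ℝ) : Prop where
  pos : ∀ n, 0 < a n
  antitone : Antitone a
  not_summable : ¬ Summable a
  summable_sq : Summable fun n => a n ^ 2

/-- The tail sum `s(n₀) = ∑_{m ≥ n₀} a(m)²`. -/
noncomputable def tailSq (a : ℕ → ℝ) (n₀ : ℕ) : ℝ := ∑' m : ℕ, a (n₀ + m) ^ 2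

/-- The time instants `t(n) = ∑_{m < n} a(m)`, so that `t(0) = 0`. -/
noncomputable def timeOf (a : ℕ → ℝ) (n : ℕ) : ℝ := ∑ m ∈ Finset.range n, a m

/-- The index `n` with `t(n) ≤ t < t(n+1)`, that is, the largest `n` with `t(n) ≤ t`
(for `t ≥ 0` and step sizes with a divergent sum). -/
noncomputable def timeIndex (a : ℕ → ℝ) (t : ℝ) : ℕ := sSup {n : ℕ | timeOf a n ≤ t}

/-- The piecewise linear interpolation `t ↦ x̄(t)` of a sequence `x`: it takes the value `x n`
at `t(n)` and is linear on `[t(n), t(n+1)]`. -/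
noncomputable def interp {d : ℕ} (a : ℕ → ℝ) (x : ℕ → E d) (t : ℝ) : E d :=
  x (timeIndex a t) +
    ((t - timeOf a (timeIndex a t)) / a (timeIndex a t)) •
      (x (timeIndex a t + 1) - x (timeIndex a t))

/-- The averaged vector field `h(θ) = ∫ f(θ, y) Γ_θ(dy)`. -/
noncomputable def meanField {d k : ℕ} (f : E d → E k → E d) (Γ : E d → Measure (E k))
    (θ : E d) : E d := ∫ y, f θ y ∂(Γ θ)

/-- `γ` is the unique invariant probability measure of the transition probability `κ`. -/
structure IsUniqueInvariantProb {k : ℕ} (κ : Kernel (E k) (E k)) (γ : Measure (E k)) : Prop where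
  isProb : IsProbabilityMeasure γ
  invariant : Kernel.Invariant κ γ
  unique : ∀ μ : Measure (E k), IsProbabilityMeasure μ → Kernel.Invariant κ μ → μ = γ

/-- `v` solves the Poisson equation `(1 - κ) v = g - ∫ g dγ`. -/
structure IsPoissonSolution {d k : ℕ} (κ : Kernel (E k) (E k)) (γ : Measure (E k))
    (g v : E k → E d) : Prop where
  measurable : Measurable v
  integrable : ∀ y, Integrable v (κ y)
  eq : ∀ y, v y - ∫ z, v z ∂(κ y) = g y - ∫ z, g z ∂γ

/-- Growth and local Lipschitz conditions on a family `θ ↦ v_θ`. -/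
def LocallyRegular {d k : ℕ} (v : E d → E k → E d) : Prop :=
  ∀ R > 0, ∃ C > 0,
    (∀ θ, ‖θ‖ ≤ R → ∀ y, ‖v θ y‖ ≤ C * (1 + ‖y‖)) ∧
    (∀ θ θ', ‖θ‖ ≤ R → ‖θ'‖ ≤ R → ∀ y, ‖v θ y - v θ' y‖ ≤ C * ‖θ - θ'‖ * (1 + ‖y‖))

/-- The domain of attraction of `H` for the differential equation `x'(t) = h(x(t))`: the initial
points whose trajectory converges to `H`, in the sense that it eventually enters every
neighbourhood of `H` (for a nonempty compact `H` this says that the distance of `x(t)` to `H`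
tends to `0`). -/
def domainOfAttraction {d : ℕ} (h : E d → E d) (H : Set (E d)) : Set (E d) :=
  {θ | ∃ x : ℝ → E d, x 0 = θ ∧ IsIntegralCurveOn x (fun _ => h) (Ici 0) ∧
    Tendsto x atTop (𝓝ˢ H)}

/-- `V` is a strict Lyapunov function on the open set `G` for `x'(t) = h(x(t))`, with zero
set `H`, a compact subset of `G`. -/
structure IsStrictLyapunov {d : ℕ} (h : E d → E d) (G H : Set (E d)) (V : E d → ℝ) : Prop where
  isOpen : IsOpen G
  differentiableOn : DifferentiableOn ℝ V G
  nonneg : ∀ θ ∈ G, 0 ≤ V θ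
  inner_nonpos : ∀ θ ∈ G, inner ℝ (gradient V θ) (h θ) ≤ 0
  zero_set : H = {θ | θ ∈ G ∧ V θ = 0}
  zero_set_inner : H = {θ | θ ∈ G ∧ inner ℝ (gradient V θ) (h θ) = 0}
  isCompact : IsCompact H

/-- On the probability space `(Ω, P)` with filtration `ℱ`, the iterates `θ`, the Markov
iterate-dependent noise `Y` and the martingale difference noise `M` satisfy
`θ_{n+1} = θ_n + a(n) [f(θ_n, Y_n) + M_{n+1}]`, with transition probabilities
`κ (θ, y) = Π_θ(y; ·)`, with `‖M_{n+1}‖ ≤ K' (1 + ‖θ_n‖)` almost surely, and with `Y_n` almost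
surely in the ball of radius `C` for all large `n`. The variable `M 0` plays no role. -/
structure IsSA {d k : ℕ} (f : E d → E k → E d) (κ : Kernel (E d × E k) (E k)) (K' C : ℝ)
    (a : ℕ → ℝ) {Ω : Type*} [mΩ : MeasurableSpace Ω] (P : Measure Ω) (ℱ : Filtration ℕ mΩ)
    (θ : ℕ → Ω → E d) (Y : ℕ → Ω → E k) (M : ℕ → Ω → E d) : Prop where
  measurable_iterate : ∀ n, Measurable[ℱ n] (θ n)
  measurable_noise : ∀ n, Measurable[ℱ n] (Y n)
  measurable_mart : ∀ n, Measurable[ℱ (n + 1)] (M (n + 1))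
  recursion : ∀ n ω, θ (n + 1) ω = θ n ω + a n • (f (θ n ω) (Y n ω) + M (n + 1) ω)
  markov : ∀ n, ∀ A : Set (E k), MeasurableSet A →
    P⟦Y (n + 1) ⁻¹' A | ℱ n⟧ =ᵐ[P] fun ω => (κ (θ n ω, Y n ω)).real A
  integrable_mart : ∀ n, Integrable (M (n + 1)) P
  condExp_mart : ∀ n, P[M (n + 1) | ℱ n] =ᵐ[P] 0
  mart_bound : ∀ n, ∀ᵐ ω ∂P, ‖M (n + 1) ω‖ ≤ K' * (1 + ‖θ n ω‖)
  noise_bound : ∀ᶠ n in atTop, ∀ᵐ ω ∂P, ‖Y n ω‖ ≤ C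

end LockIn

namespace LockIn

/-! The iteration is an Euler scheme for the limiting differential equation plus noise. The Poisson
equation splits the noise `f(θ_n, Y_n) - h(θ_n) + M_{n+1}` into the martingale difference
`martNoise` and the difference `v_{θ_n}(Y_n) - v_{θ_n}(Y_{n+1})`. Weighted by `a n`, the second part
telescopes up to small errors (`norm_sum_poisson_diff_le`), so its sums over any block starting at
or after `n₀` are `O(a(n₀) + s(n₀))` while the iterates stay bounded. The first part, cut off
outside a large ball, has increments of size `O(a n)`; a maximal Azuma–Hoeffding inequality keeps
all its partial sums from `n₀` on below a multiple of `δ`, except with conditional probability at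
most one of the exponentials.

Off this exceptional event the argument is deterministic. By compactness, one time `T` brings every
trajectory from the closure of `B` into the `ε₁`-neighbourhood of `H` for good
(`exists_time_forall_mem_thickening`). By a discrete Gronwall estimate the iterates shadow the flow
within `δ` over a time window of bounded length, hence return to `B`, and the window can be
restarted: the iterates are trapped (`norm_le_and_mem_thickening_of_noise_le`).

Convergence to `H` needs no further loss of probability. The same inequality makes the sums of the
cut-off noise almost surely Cauchy, so far enough out the trapping argument applies again with
arbitrarily small neighbourhoods of `H` (`eventually_mem_thickening_of_noise`). -/

/-! ### Maximal Azuma–Hoeffding inequalities. -/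

/-- The exponential lies below its chord on `[-l c, l c]`. The right side is affine in `z`, so for a
centred `z` only `cosh (l c)` survives integration. -/
theorem exp_mul_le_cosh_add {c z : ℝ} (hz : |z| ≤ c) (l : ℝ) :
    Real.exp (l * z) ≤ Real.cosh (l * c) + z * (Real.sinh (l * c) / c) := by
  rcases eq_or_lt_of_le ((abs_nonneg z).trans hz) with hc | hc
  · subst hc
    have : z = 0 := abs_eq_zero.1 (le_antisymm hz (abs_nonneg z))
    simp [this]
  · have h1 := abs_le.1 hz
    have hp : 0 ≤ (1 + z / c) / 2 := by
      have : -1 ≤ z / c := by rw [le_div_iff₀ hc]; linarith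
      linarith
    have hq : 0 ≤ (1 - z / c) / 2 := by
      have : z / c ≤ 1 := by rw [div_le_iff₀ hc]; linarith
      linarith
    have h := convexOn_exp.2 (mem_univ (l * c)) (mem_univ (-(l * c))) hp hq (by ring)
    simp only [smul_eq_mul] at h
    have e : (1 + z / c) / 2 * (l * c) + (1 - z / c) / 2 * -(l * c) = l * z := by
      field_simp; ring
    rw [e] at h
    refine h.trans (le_of_eq ?_)
    rw [Real.cosh_eq, Real.sinh_eq]
    field_simp
    ring

section Azuma

theorem integral_mul_eq_zero_of_condExp {Ω : Type*} {m mΩ : MeasurableSpace Ω} {P : Measure Ω}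
    [IsProbabilityMeasure P] (hm : m ≤ mΩ) {W z : Ω → ℝ}
    (hW : StronglyMeasurable[m] W) (hz : Integrable z P) (hWz : Integrable (W * z) P)
    (h0 : P[z | m] =ᵐ[P] 0) : ∫ ω, W ω * z ω ∂P = 0 := by
  have h1 := condExp_mul_of_stronglyMeasurable_left hW hWz hz
  have h2 : P[W * z | m] =ᵐ[P] 0 := by
    filter_upwards [h1, h0] with ω h1 h0
    simp [h1, h0]
  have h3 := integral_condExp hm (μ := P) (f := W * z)
  rw [integral_congr_ae h2] at h3
  simpa using h3.symm

theorem integral_mul_exp_le {Ω : Type*} {m mΩ : MeasurableSpace Ω} {P : Measure Ω}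
    [IsProbabilityMeasure P] (hm : m ≤ mΩ) {W z : Ω → ℝ} {c : ℝ}
    (hW : StronglyMeasurable[m] W) (hW0 : 0 ≤ W) (hWi : Integrable W P)
    (hz : Measurable z) (hzc : ∀ᵐ ω ∂P, |z ω| ≤ c) (h0 : P[z | m] =ᵐ[P] 0) (l : ℝ) :
    ∫ ω, W ω * Real.exp (l * z ω) ∂P ≤ Real.exp ((l * c) ^ 2 / 2) * ∫ ω, W ω ∂P := by
  have hzi : Integrable z P := by
    refine Integrable.of_bound hz.aestronglyMeasurable c ?_
    simpa using hzc
  have hWz : Integrable (fun ω => W ω * z ω) P :=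
    hWi.mul_bdd hz.aestronglyMeasurable (c := c) (by simpa using hzc)
  have hz0 := integral_mul_eq_zero_of_condExp hm hW hzi hWz h0
  have hle : ∫ ω, W ω * Real.exp (l * z ω) ∂P ≤
      ∫ ω, (Real.cosh (l * c) * W ω + (Real.sinh (l * c) / c) * (W ω * z ω)) ∂P := by
    refine integral_mono_of_nonneg ?_ ((hWi.const_mul _).add (hWz.const_mul _)) ?_
    · exact Eventually.of_forall fun ω => mul_nonneg (hW0 ω) (Real.exp_pos _).le
    · filter_upwards [hzc] with ω hω
      have := mul_le_mul_of_nonneg_left (exp_mul_le_cosh_add hω l) (hW0 ω)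
      linarith
  rw [integral_add (hWi.const_mul _) (hWz.const_mul _), integral_const_mul, integral_const_mul,
    hz0, mul_zero, add_zero] at hle
  exact hle.trans (mul_le_mul_of_nonneg_right (Real.cosh_le_exp_half_sq _)
    (integral_nonneg hW0))

variable {Ω : Type*} [mΩ : MeasurableSpace Ω] {P : Measure Ω} [IsProbabilityMeasure P]

variable {𝒢 : Filtration ℕ mΩ} {ζ : ℕ → Ω → ℝ} {c : ℕ → ℝ}

theorem measurable_partialSum (hmeas : ∀ n, Measurable[𝒢 (n + 1)] (ζ n)) (n : ℕ) :
    Measurable[𝒢 n] (fun ω => ∑ i ∈ Finset.range n, ζ i ω) := by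
  refine Finset.measurable_fun_sum _ fun i hi => ?_
  exact (hmeas i).mono (𝒢.mono (Finset.mem_range.1 hi)) le_rfl

theorem integral_indicator_exp_partialSum_le (hmeas : ∀ n, Measurable[𝒢 (n + 1)] (ζ n))
    (hb : ∀ n, ∀ᵐ ω ∂P, |ζ n ω| ≤ c n) (h0 : ∀ n, P[ζ n | 𝒢 n] =ᵐ[P] 0)
    {B : Set Ω} (hB : MeasurableSet[𝒢 0] B) (l : ℝ) (n : ℕ) :
    Integrable (B.indicator fun ω => Real.exp (l * ∑ i ∈ Finset.range n, ζ i ω)) P ∧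
    ∫ ω, B.indicator (fun ω => Real.exp (l * ∑ i ∈ Finset.range n, ζ i ω)) ω ∂P ≤
      Real.exp (l ^ 2 * (∑ i ∈ Finset.range n, c i ^ 2) / 2) * P.real B := by
  have hBm : MeasurableSet B := 𝒢.le 0 _ hB
  induction n with
  | zero =>
    constructor
    · simpa using (integrable_const (1 : ℝ)).indicator hBm
    · simp only [Finset.range_zero, Finset.sum_empty, mul_zero, Real.exp_zero, zero_div, one_mul]
      rw [integral_indicator hBm]
      simp
  | succ n ih =>
    set W : Ω → ℝ := B.indicator fun ω => Real.exp (l * ∑ i ∈ Finset.range n, ζ i ω) with hWdef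
    have hWm : Measurable[𝒢 n] W :=
      Measurable.indicator (((measurable_partialSum hmeas n).const_mul l).exp)
        (𝒢.mono (Nat.zero_le n) _ hB)
    have hW0 : 0 ≤ W := fun ω => indicator_nonneg (fun _ _ => (Real.exp_pos _).le) ω
    have hzm : Measurable (ζ n) := (hmeas n).mono (𝒢.le _) le_rfl
    have hstep : (B.indicator fun ω => Real.exp (l * ∑ i ∈ Finset.range (n + 1), ζ i ω)) =
        fun ω => W ω * Real.exp (l * ζ n ω) := by
      ext ω
      by_cases hω : ω ∈ B
      · simp [hWdef, hω, Finset.sum_range_succ, mul_add, Real.exp_add]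
      · simp [hWdef, hω]
    have hle := integral_mul_exp_le (𝒢.le n) hWm.stronglyMeasurable hW0 ih.1 hzm (hb n) (h0 n) l
    rw [hstep]
    constructor
    · refine ih.1.mul_bdd (c := Real.exp (|l| * c n))
        (hzm.const_mul l).exp.aestronglyMeasurable ?_
      filter_upwards [hb n] with ω hω
      rw [Real.norm_eq_abs, Real.abs_exp, Real.exp_le_exp]
      calc l * ζ n ω ≤ |l * ζ n ω| := le_abs_self _
        _ = |l| * |ζ n ω| := abs_mul _ _
        _ ≤ |l| * c n := by gcongr
    · refine hle.trans ?_
      calc _ ≤ Real.exp ((l * c n) ^ 2 / 2) *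
            (Real.exp (l ^ 2 * (∑ i ∈ Finset.range n, c i ^ 2) / 2) * P.real B) := by
            gcongr; exact ih.2
        _ = _ := by
            rw [← mul_assoc, ← Real.exp_add, Finset.sum_range_succ]; ring_nf

theorem measureReal_partialSum_ge_le (hmeas : ∀ n, Measurable[𝒢 (n + 1)] (ζ n))
    (hb : ∀ n, ∀ᵐ ω ∂P, |ζ n ω| ≤ c n) (h0 : ∀ n, P[ζ n | 𝒢 n] =ᵐ[P] 0)
    {B : Set Ω} (hB : MeasurableSet[𝒢 0] B) {Q η : ℝ} (hQ : 0 < Q) (hη : 0 ≤ η) (n : ℕ)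
    (hcQ : ∑ i ∈ Finset.range n, c i ^ 2 ≤ Q) :
    P.real (B ∩ {ω | η ≤ ∑ i ∈ Finset.range n, ζ i ω}) ≤
      P.real B * Real.exp (-(η ^ 2 / (2 * Q))) := by
  have hBm : MeasurableSet B := 𝒢.le 0 _ hB
  set l := η / Q with hl
  have hl0 : 0 ≤ l := by positivity
  obtain ⟨hi, hle⟩ := integral_indicator_exp_partialSum_le hmeas hb h0 hB l n
  have hmk := mul_meas_ge_le_integral_of_nonneg
    (Eventually.of_forall fun ω => indicator_nonneg (fun _ _ => (Real.exp_pos _).le) ω) hi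
    (Real.exp (l * η))
  have hsub : P.real (B ∩ {ω | η ≤ ∑ i ∈ Finset.range n, ζ i ω}) ≤
      P.real {ω | Real.exp (l * η) ≤
        B.indicator (fun ω => Real.exp (l * ∑ i ∈ Finset.range n, ζ i ω)) ω} := by
    refine measureReal_mono ?_
    rintro ω ⟨h1, h2⟩
    simp only [mem_ofPred_eq, indicator_of_mem h1] at h2 ⊢
    exact Real.exp_le_exp.2 (mul_le_mul_of_nonneg_left h2 hl0)
  have h1 : Real.exp (l * η) * P.real (B ∩ {ω | η ≤ ∑ i ∈ Finset.range n, ζ i ω}) ≤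
      Real.exp (l ^ 2 * Q / 2) * P.real B := by
    refine (mul_le_mul_of_nonneg_left hsub (Real.exp_pos _).le).trans (hmk.trans (hle.trans ?_))
    gcongr
  have h2 : Real.exp (-(η ^ 2 / (2 * Q))) = Real.exp (l ^ 2 * Q / 2) / Real.exp (l * η) := by
    rw [← Real.exp_sub, hl]
    congr 1
    field_simp
    ring
  rw [h2, mul_div_assoc', le_div_iff₀ (Real.exp_pos _)]
  linarith

/-- The sum is stopped when it first reaches `η`. Freezing keeps the martingale difference property
and the bounds, and turns the maximal event into an event about the final sum, to which the Chernoff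
bound applies. -/
theorem measureReal_exists_le_partialSum_ge_le (hmeas : ∀ n, Measurable[𝒢 (n + 1)] (ζ n))
    (hb : ∀ n, ∀ᵐ ω ∂P, |ζ n ω| ≤ c n) (h0 : ∀ n, P[ζ n | 𝒢 n] =ᵐ[P] 0)
    {B : Set Ω} (hB : MeasurableSet[𝒢 0] B) {Q η : ℝ} (hQ : 0 < Q) (hη : 0 ≤ η) (n : ℕ)
    (hcQ : ∑ i ∈ Finset.range n, c i ^ 2 ≤ Q) :
    P.real (B ∩ {ω | ∃ j ≤ n, η ≤ ∑ i ∈ Finset.range j, ζ i ω}) ≤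
      P.real B * Real.exp (-(η ^ 2 / (2 * Q))) := by
  set D : ℕ → Set Ω := fun m => {ω | ∀ j ≤ m, ∑ i ∈ Finset.range j, ζ i ω < η} with hD
  have hDm : ∀ m, MeasurableSet[𝒢 m] (D m) := by
    intro m
    have : D m = ⋂ j : Fin (m + 1), {ω | ∑ i ∈ Finset.range j, ζ i ω < η} := by
      ext ω
      simp only [hD, mem_ofPred_eq, mem_iInter, Fin.forall_iff, Nat.lt_succ_iff]
    rw [this]
    refine @MeasurableSet.iInter Ω _ (𝒢 m) _ _ fun j => ?_
    exact ((measurable_partialSum hmeas j).mono (𝒢.mono (Nat.lt_succ_iff.1 j.2)) le_rfl)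
      measurableSet_Iio
  set ξ : ℕ → Ω → ℝ := fun m => (D m).indicator (ζ m) with hξ
  have hξmeas : ∀ m, Measurable[𝒢 (m + 1)] (ξ m) := fun m =>
    (hmeas m).indicator (𝒢.mono (Nat.le_succ m) _ (hDm m))
  have hξb : ∀ m, ∀ᵐ ω ∂P, |ξ m ω| ≤ c m := by
    intro m
    filter_upwards [hb m] with ω hω
    by_cases h : ω ∈ D m
    · simpa [hξ, h] using hω
    · simpa [hξ, h] using (abs_nonneg _).trans hω
  have hξ0 : ∀ m, P[ξ m | 𝒢 m] =ᵐ[P] 0 := by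
    intro m
    have hzi : Integrable (ζ m) P :=
      Integrable.of_bound ((hmeas m).mono (𝒢.le _) le_rfl).aestronglyMeasurable (c m)
        (by simpa using hb m)
    filter_upwards [condExp_indicator hzi (hDm m), h0 m] with ω h1 h2
    by_cases h : ω ∈ D m <;> simp [hξ, h1, h2, h]
  refine le_trans (measureReal_mono ?_)
    (measureReal_partialSum_ge_le hξmeas hξb hξ0 hB hQ hη n hcQ)
  rintro ω ⟨hωB, j, hj, hjη⟩
  refine ⟨hωB, ?_⟩
  classical
  have hex : ∃ j, η ≤ ∑ i ∈ Finset.range j, ζ i ω := ⟨j, hjη⟩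
  set τ := Nat.find hex with hτ
  have hτn : τ ≤ n := (Nat.find_min' hex hjη).trans hj
  have hlt : ∀ i < τ, ξ i ω = ζ i ω := by
    intro i hi
    have : ω ∈ D i := fun j' hj' => not_le.1 (Nat.find_min hex (lt_of_le_of_lt hj' hi))
    simp [hξ, this]
  have hge : ∀ i, τ ≤ i → ξ i ω = 0 := by
    intro i hi
    have : ω ∉ D i := fun h => absurd (h τ hi) (not_lt.2 (Nat.find_spec hex))
    simp [hξ, this]
  have : ∑ i ∈ Finset.range n, ξ i ω = ∑ i ∈ Finset.range τ, ζ i ω := by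
    rw [← Finset.sum_range_add_sum_Ico _ hτn,
      Finset.sum_congr rfl fun i hi => hlt i (Finset.mem_range.1 hi),
      Finset.sum_eq_zero fun i hi => hge i (Finset.mem_Ico.1 hi).1, add_zero]
  simp only [mem_ofPred_eq, this]
  exact Nat.find_spec hex

theorem measureReal_exists_partialSum_ge_le (hmeas : ∀ n, Measurable[𝒢 (n + 1)] (ζ n))
    (hb : ∀ n, ∀ᵐ ω ∂P, |ζ n ω| ≤ c n) (h0 : ∀ n, P[ζ n | 𝒢 n] =ᵐ[P] 0)
    {B : Set Ω} (hB : MeasurableSet[𝒢 0] B) {Q η : ℝ} (hQ : 0 < Q) (hη : 0 ≤ η)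
    (hcQ : ∀ n, ∑ i ∈ Finset.range n, c i ^ 2 ≤ Q) :
    P.real (B ∩ {ω | ∃ j, η ≤ ∑ i ∈ Finset.range j, ζ i ω}) ≤
      P.real B * Real.exp (-(η ^ 2 / (2 * Q))) := by
  have hU : B ∩ {ω | ∃ j, η ≤ ∑ i ∈ Finset.range j, ζ i ω} =
      ⋃ n, B ∩ {ω | ∃ j ≤ n, η ≤ ∑ i ∈ Finset.range j, ζ i ω} := by
    ext ω
    simp only [mem_inter_iff, mem_ofPred_eq, mem_iUnion]
    exact ⟨fun ⟨h, j, hj⟩ => ⟨j, h, j, le_rfl, hj⟩, fun ⟨_, h, j, _, hj⟩ => ⟨h, j, hj⟩⟩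
  have hmono : Monotone fun n => B ∩ {ω | ∃ j ≤ n, η ≤ ∑ i ∈ Finset.range j, ζ i ω} :=
    fun n m hnm ω ⟨h, j, hj, hjη⟩ => ⟨h, j, hj.trans hnm, hjη⟩
  have ht := tendsto_measure_iUnion_atTop (μ := P) hmono
  rw [← hU] at ht
  have ht' := (ENNReal.tendsto_toReal (measure_ne_top _ _)).comp ht
  exact le_of_tendsto ht' (Eventually.of_forall fun n =>
    measureReal_exists_le_partialSum_ge_le hmeas hb h0 hB hQ hη n (hcQ n))

theorem measureReal_exists_abs_partialSum_ge_le (hmeas : ∀ n, Measurable[𝒢 (n + 1)] (ζ n))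
    (hb : ∀ n, ∀ᵐ ω ∂P, |ζ n ω| ≤ c n) (h0 : ∀ n, P[ζ n | 𝒢 n] =ᵐ[P] 0)
    {B : Set Ω} (hB : MeasurableSet[𝒢 0] B) {Q η : ℝ} (hQ : 0 < Q) (hη : 0 ≤ η)
    (hcQ : ∀ n, ∑ i ∈ Finset.range n, c i ^ 2 ≤ Q) :
    P.real (B ∩ {ω | ∃ j, η ≤ |∑ i ∈ Finset.range j, ζ i ω|}) ≤
      2 * (P.real B * Real.exp (-(η ^ 2 / (2 * Q)))) := by
  have h1 := measureReal_exists_partialSum_ge_le hmeas hb h0 hB hQ hη hcQ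
  have h2 := measureReal_exists_partialSum_ge_le (ζ := fun n => -ζ n)
    (fun n => (hmeas n).neg) (fun n => by simpa using hb n)
    (fun n => by
      filter_upwards [condExp_neg (μ := P) (ζ n) (𝒢 n), h0 n] with ω h1 h2
      simp [h1, h2]) hB hQ hη hcQ
  have hsub : B ∩ {ω | ∃ j, η ≤ |∑ i ∈ Finset.range j, ζ i ω|} ⊆
      (B ∩ {ω | ∃ j, η ≤ ∑ i ∈ Finset.range j, ζ i ω}) ∪
      (B ∩ {ω | ∃ j, η ≤ ∑ i ∈ Finset.range j, (-ζ i) ω}) := by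
    rintro ω ⟨hω, j, hj⟩
    rcases le_abs.1 hj with h | h
    · exact Or.inl ⟨hω, j, h⟩
    · exact Or.inr ⟨hω, j, by simpa using h⟩
  have := (measureReal_mono hsub).trans (measureReal_union_le (μ := P) _ _)
  linarith

/-- Maximal Azuma–Hoeffding inequality for vector valued martingale differences, localised on an
event known at the initial time. -/
theorem measureReal_exists_norm_partialSum_ge_le {d : ℕ} (hd : 0 < d) {X : ℕ → Ω → E d}
    (hmeas : ∀ n, Measurable[𝒢 (n + 1)] (X n))
    (hb : ∀ n, ∀ᵐ ω ∂P, ‖X n ω‖ ≤ c n) (h0 : ∀ n, P[X n | 𝒢 n] =ᵐ[P] 0)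
    {B : Set Ω} (hB : MeasurableSet[𝒢 0] B) {Q η : ℝ} (hQ : 0 < Q) (hη : 0 ≤ η)
    (hcQ : ∀ n, ∑ i ∈ Finset.range n, c i ^ 2 ≤ Q) :
    P.real (B ∩ {ω | ∃ j, η ≤ ‖∑ i ∈ Finset.range j, X i ω‖}) ≤
      P.real B * (2 * d * Real.exp (-(η ^ 2 / (2 * d * Q)))) := by
  have hd' : (0 : ℝ) < d := by exact_mod_cast hd
  have hsd : 0 < √(d : ℝ) := Real.sqrt_pos.2 hd'
  have hXi : ∀ n, Integrable (X n) P := fun n =>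
    Integrable.of_bound ((hmeas n).mono (𝒢.le _) le_rfl).aestronglyMeasurable (c n) (hb n)
  have hcoord : ∀ i : Fin d, P.real (B ∩ {ω | ∃ j, η / √d ≤ |∑ m ∈ Finset.range j, X m ω i|}) ≤
      2 * (P.real B * Real.exp (-((η / √d) ^ 2 / (2 * Q)))) := by
    intro i
    refine measureReal_exists_abs_partialSum_ge_le (𝒢 := 𝒢) (ζ := fun m ω => X m ω i) (c := c)
      (fun n => ?_) (fun n => ?_) (fun n => ?_) hB hQ (by positivity) hcQ
    · exact (EuclideanSpace.proj (𝕜 := ℝ) i).continuous.measurable.comp (hmeas n)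
    · filter_upwards [hb n] with ω hω
      exact (PiLp.norm_apply_le (X n ω) i).trans hω
    · have := ContinuousLinearMap.comp_condExp_comm (m := 𝒢 n) (hXi n)
        (EuclideanSpace.proj (𝕜 := ℝ) i : E d →L[ℝ] ℝ)
      filter_upwards [this, h0 n] with ω h1 h2
      simp only [Function.comp_apply] at h1
      rw [h2] at h1
      have h3 : (P[fun ω => X n ω i | 𝒢 n]) ω = _ := h1.symm
      simpa using h3
  -- A vector of norm at least `η` has a coordinate of size at least `η / √d`; this produces both
  -- the prefactor and the `d` in the exponent.
  have hsub : B ∩ {ω | ∃ j, η ≤ ‖∑ i ∈ Finset.range j, X i ω‖} ⊆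
      ⋃ i ∈ (Finset.univ : Finset (Fin d)),
        B ∩ {ω | ∃ j, η / √d ≤ |∑ m ∈ Finset.range j, X m ω i|} := by
    rintro ω ⟨hω, j, hj⟩
    simp only [Finset.mem_univ, iUnion_true, mem_iUnion]
    by_contra! hcon
    have hlt : ∀ i, |(∑ m ∈ Finset.range j, X m ω) i| < η / √d := by
      intro i
      by_contra! hge
      refine hcon i ⟨hω, j, ?_⟩
      have : (∑ m ∈ Finset.range j, X m ω) i = ∑ m ∈ Finset.range j, X m ω i :=
        map_sum (EuclideanSpace.proj (𝕜 := ℝ) i : E d →L[ℝ] ℝ) _ _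
      rwa [← this]
    have hnorm : ‖∑ m ∈ Finset.range j, X m ω‖ ^ 2 < η ^ 2 := by
      rw [EuclideanSpace.norm_sq_eq]
      have : Nonempty (Fin d) := ⟨⟨0, hd⟩⟩
      calc _ < ∑ i : Fin d, (η / √d) ^ 2 := by
            refine Finset.sum_lt_sum_of_nonempty Finset.univ_nonempty fun i _ => ?_
            exact pow_lt_pow_left₀ (hlt i) (abs_nonneg _) two_ne_zero
        _ = η ^ 2 := by
            simp [div_pow, Real.sq_sqrt hd'.le]; field_simp
    exact absurd hnorm (not_lt.2 (pow_le_pow_left₀ hη hj 2))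
  refine (measureReal_mono hsub (measure_ne_top _ _)).trans
    ((measureReal_biUnion_finset_le _ _).trans ((Finset.sum_le_sum fun i _ => hcoord i).trans ?_))
  simp only [Finset.sum_const, Finset.card_univ, Fintype.card_fin, nsmul_eq_mul, div_pow,
    Real.sq_sqrt hd'.le]
  refine le_of_eq ?_
  have : η ^ 2 / d / (2 * Q) = η ^ 2 / (2 * d * Q) := by field_simp
  rw [this]; ring

end Azuma

/-! ### The Markov noise as a martingale difference. -/

theorem LocallyRegular.continuous {d k : ℕ} {v : E d → E k → E d} (hv : LocallyRegular v)
    (y : E k) : Continuous fun θ => v θ y := by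
  rw [continuous_iff_continuousAt]
  intro θ₀
  obtain ⟨c, hc, -, hlip⟩ := hv (‖θ₀‖ + 1) (by positivity)
  rw [ContinuousAt, tendsto_iff_norm_sub_tendsto_zero]
  have hlim : Tendsto (fun θ => c * ‖θ - θ₀‖ * (1 + ‖y‖)) (𝓝 θ₀) (𝓝 0) := by
    have : Continuous fun θ : E d => c * ‖θ - θ₀‖ * (1 + ‖y‖) := by fun_prop
    simpa using this.tendsto θ₀
  refine squeeze_zero' (Eventually.of_forall fun _ => norm_nonneg _) ?_ hlim
  filter_upwards [Metric.ball_mem_nhds θ₀ one_pos] with θ hθ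
  refine hlip θ θ₀ ?_ (by linarith) y
  have h1 : ‖θ - θ₀‖ < 1 := by simpa [dist_eq_norm] using hθ
  have h2 := norm_sub_norm_le θ θ₀
  linarith

theorem LocallyRegular.measurable_uncurry {d k : ℕ} {v : E d → E k → E d}
    (hv : LocallyRegular v) (hm : ∀ θ, Measurable (v θ)) : Measurable (Function.uncurry v) :=
  measurable_uncurry_of_continuous_of_measurable hv.continuous hm

theorem stronglyMeasurable_integral_kernel {d k : ℕ} {v : E d → E k → E d}
    (hv : Measurable (Function.uncurry v)) (κ : Kernel (E d × E k) (E k)) [IsMarkovKernel κ] :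
    StronglyMeasurable fun p : E d × E k => ∫ z, v p.1 z ∂(κ p) := by
  have h : StronglyMeasurable fun q : (E d × E k) × E k => v q.1.1 q.2 :=
    (hv.comp ((measurable_fst.comp measurable_fst).prodMk measurable_snd)).stronglyMeasurable
  exact h.integral_kernel_prod_right'

/-- The martingale part of the noise in the Poisson equation decomposition. -/
noncomputable def martNoise {d k : ℕ} {Ω : Type*} (κ : Kernel (E d × E k) (E k))
    (v : E d → E k → E d) (θ : ℕ → Ω → E d) (Y : ℕ → Ω → E k) (M : ℕ → Ω → E d) (n : ℕ) (ω : Ω) :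
    E d :=
  M (n + 1) ω + (v (θ n ω) (Y (n + 1) ω) - ∫ z, v (θ n ω) z ∂(κ (θ n ω, Y n ω)))

section

variable {d k : ℕ} {f : E d → E k → E d} {κ : Kernel (E d × E k) (E k)}
  {v : E d → E k → E d} {K' C : ℝ} {a : ℕ → ℝ} {Ω : Type*} [mΩ : MeasurableSpace Ω] {P : Measure Ω}
  {ℱ : Filtration ℕ mΩ}
  {θ : ℕ → Ω → E d} {Y : ℕ → Ω → E k} {M : ℕ → Ω → E d}

theorem IsSA.measurable_pair (h : IsSA f κ K' C a P ℱ θ Y M) (n : ℕ) :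
    Measurable[ℱ n] fun ω => (θ n ω, Y n ω) :=
  (h.measurable_iterate n).prodMk (h.measurable_noise n)

variable [IsMarkovKernel κ]

theorem IsSA.measurable_martNoise (h : IsSA f κ K' C a P ℱ θ Y M)
    (hv : Measurable (Function.uncurry v)) (n : ℕ) :
    Measurable[ℱ (n + 1)] (martNoise κ v θ Y M n) := by
  have hle := ℱ.mono (Nat.le_succ n)
  refine (h.measurable_mart n).add (Measurable.sub ?_ ?_)
  · exact hv.comp (((h.measurable_iterate n).mono hle le_rfl).prodMk (h.measurable_noise (n + 1)))
  · exact (stronglyMeasurable_integral_kernel hv κ).measurable.comp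
      ((h.measurable_pair n).mono hle le_rfl)

variable [IsProbabilityMeasure P]

theorem IsSA.setLIntegral_kernel (h : IsSA f κ K' C a P ℱ θ Y M) {n : ℕ} {A : Set Ω}
    (hA : MeasurableSet[ℱ n] A) {D : Set (E k)} (hD : MeasurableSet D) :
    ∫⁻ ω in A, κ (θ n ω, Y n ω) D ∂P = P (A ∩ Y (n + 1) ⁻¹' D) := by
  have hYD : MeasurableSet (Y (n + 1) ⁻¹' D) := (h.measurable_noise (n + 1)).mono (ℱ.le _) le_rfl hD
  have hm : Measurable fun ω => κ (θ n ω, Y n ω) D :=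
    (κ.measurable_coe hD).comp ((h.measurable_pair n).mono (ℱ.le _) le_rfl)
  have h1 : ∫ ω in A, (κ (θ n ω, Y n ω)).real D ∂P = P.real (A ∩ Y (n + 1) ⁻¹' D) := by
    rw [← setIntegral_congr_ae₀ (ℱ.le n _ hA).nullMeasurableSet
      ((h.markov n D hD).mono fun ω hω _ => hω),
      setIntegral_condExp (ℱ.le n) ((integrable_const (1 : ℝ)).indicator hYD) hA,
      setIntegral_indicator hYD]
    simp
  have h2 := integral_toReal (μ := P.restrict A) hm.aemeasurable
    (Eventually.of_forall fun ω => measure_lt_top _ _)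
  have h3 : (∫⁻ ω in A, κ (θ n ω, Y n ω) D ∂P).toReal = (P (A ∩ Y (n + 1) ⁻¹' D)).toReal :=
    h2.symm.trans h1
  refine (ENNReal.toReal_eq_toReal_iff' ?_ (measure_ne_top _ _)).1 h3
  refine ne_top_of_le_ne_top (measure_ne_top P A) ?_
  calc _ ≤ ∫⁻ ω in A, 1 ∂P := lintegral_mono fun ω => prob_le_one
    _ = P A := by simp

/-- The Markov property is given for fixed sets, but is needed for `v_{θ_n}(Y_{n+1})` with a random
parameter. Identifying the joint law of `(θ_n, Y_{n+1})` on past events, by checking rectangles,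
bridges the gap. -/
theorem IsSA.map_iterate_noise (h : IsSA f κ K' C a P ℱ θ Y M) {n : ℕ} {A : Set Ω}
    (hA : MeasurableSet[ℱ n] A) :
    (P.restrict A).map (fun ω => (θ n ω, Y (n + 1) ω)) =
      (((P.restrict A).map fun ω => (θ n ω, Y n ω)) ⊗ₘ κ).map fun q => (q.1.1, q.2) := by
  have hpair : Measurable fun ω => (θ n ω, Y n ω) := (h.measurable_pair n).mono (ℱ.le _) le_rfl
  have hθ : Measurable (θ n) := (h.measurable_iterate n).mono (ℱ.le _) le_rfl
  have hY : Measurable (Y (n + 1)) := (h.measurable_noise (n + 1)).mono (ℱ.le _) le_rfl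
  refine Measure.ext_prod fun {S D} hS hD => ?_
  rw [Measure.map_apply (hθ.prodMk hY) (hS.prod hD), Measure.map_apply (by fun_prop) (hS.prod hD)]
  have e : (fun q : (E d × E k) × E k => (q.1.1, q.2)) ⁻¹' S ×ˢ D = (Prod.fst ⁻¹' S) ×ˢ D := by
    ext q; simp
  have hS' : MeasurableSet (Prod.fst ⁻¹' S : Set (E d × E k)) := measurable_fst hS
  have hSA : MeasurableSet[ℱ n] (θ n ⁻¹' S ∩ A) := (h.measurable_iterate n hS).inter hA
  rw [e, Measure.compProd_apply_prod hS' hD,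
    setLIntegral_map hS' (κ.measurable_coe hD) hpair,
    Measure.restrict_restrict (hpair hS'),
    Measure.restrict_apply ((hθ.prodMk hY) (hS.prod hD))]
  have e2 : (fun ω => (θ n ω, Y n ω)) ⁻¹' (Prod.fst ⁻¹' S) = θ n ⁻¹' S := rfl
  rw [e2, h.setLIntegral_kernel hSA hD]
  congr 1
  ext ω
  simp only [mem_inter_iff, mem_preimage, mem_prod]
  tauto

theorem IsSA.setIntegral_kernel (h : IsSA f κ K' C a P ℱ θ Y M)
    (hv : Measurable (Function.uncurry v)) {n : ℕ} {A : Set Ω} (hA : MeasurableSet[ℱ n] A)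
    {c : ℝ} (hb : ∀ᵐ ω ∂P, ω ∈ A → ‖v (θ n ω) (Y (n + 1) ω)‖ ≤ c) :
    IntegrableOn (fun ω => v (θ n ω) (Y (n + 1) ω)) A P ∧
    IntegrableOn (fun ω => ∫ z, v (θ n ω) z ∂(κ (θ n ω, Y n ω))) A P ∧
    ∫ ω in A, (v (θ n ω) (Y (n + 1) ω) - ∫ z, v (θ n ω) z ∂(κ (θ n ω, Y n ω))) ∂P = 0 := by
  have hpair : Measurable fun ω => (θ n ω, Y n ω) := (h.measurable_pair n).mono (ℱ.le _) le_rfl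
  have hθ : Measurable (θ n) := (h.measurable_iterate n).mono (ℱ.le _) le_rfl
  have hY : Measurable (Y (n + 1)) := (h.measurable_noise (n + 1)).mono (ℱ.le _) le_rfl
  have hθY := hθ.prodMk hY
  have hI1 : IntegrableOn (fun ω => v (θ n ω) (Y (n + 1) ω)) A P := by
    refine Integrable.of_bound (hv.comp hθY).aestronglyMeasurable c ?_
    exact (ae_restrict_iff' (ℱ.le n _ hA)).2 hb
  have hI2 : Integrable (Function.uncurry v)
      ((P.restrict A).map fun ω => (θ n ω, Y (n + 1) ω)) :=
    (integrable_map_measure hv.aestronglyMeasurable hθY.aemeasurable).2 hI1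
  have hproj : Measurable fun q : (E d × E k) × E k => (q.1.1, q.2) := by fun_prop
  have hI3 : Integrable (fun q : (E d × E k) × E k => v q.1.1 q.2)
      (((P.restrict A).map fun ω => (θ n ω, Y n ω)) ⊗ₘ κ) := by
    rw [h.map_iterate_noise hA] at hI2
    exact (integrable_map_measure hv.aestronglyMeasurable hproj.aemeasurable).1 hI2
  have hI4 := Integrable.integral_compProd hI3
  have hsm := stronglyMeasurable_integral_kernel hv κ
  have hI5 : IntegrableOn (fun ω => ∫ z, v (θ n ω) z ∂(κ (θ n ω, Y n ω))) A P :=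
    (integrable_map_measure hsm.aestronglyMeasurable hpair.aemeasurable).1 hI4
  refine ⟨hI1, hI5, ?_⟩
  rw [integral_sub hI1 hI5, sub_eq_zero]
  calc _ = ∫ q, Function.uncurry v q ∂((P.restrict A).map fun ω => (θ n ω, Y (n + 1) ω)) :=
        (integral_map hθY.aemeasurable hv.aestronglyMeasurable).symm
    _ = ∫ q : (E d × E k) × E k, v q.1.1 q.2
          ∂(((P.restrict A).map fun ω => (θ n ω, Y n ω)) ⊗ₘ κ) := by
        rw [h.map_iterate_noise hA, integral_map hproj.aemeasurable hv.aestronglyMeasurable]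
        rfl
    _ = _ := by
        rw [Measure.integral_compProd hI3,
          integral_map hpair.aemeasurable hsm.aestronglyMeasurable]

theorem IsSA.condExp_indicator_martNoise (h : IsSA f κ K' C a P ℱ θ Y M)
    (hv : Measurable (Function.uncurry v)) {n : ℕ} {A : Set Ω} (hA : MeasurableSet[ℱ n] A)
    {c : ℝ} (hb : ∀ᵐ ω ∂P, ω ∈ A → ‖v (θ n ω) (Y (n + 1) ω)‖ ≤ c)
    (hint : Integrable (A.indicator (martNoise κ v θ Y M n)) P) :
    P[A.indicator (martNoise κ v θ Y M n) | ℱ n] =ᵐ[P] 0 := by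
  refine (ae_eq_condExp_of_forall_setIntegral_eq (ℱ.le n) hint
    (fun _ _ _ => integrableOn_zero) (fun s hs _ => ?_)
    (stronglyMeasurable_zero.aestronglyMeasurable)).symm
  have hAm := ℱ.le n _ hA
  have hsA : MeasurableSet[ℱ n] (s ∩ A) := hs.inter hA
  obtain ⟨h1, h2, h3⟩ := h.setIntegral_kernel (v := v) hv hsA
    (hb.mono fun ω hω hmem => hω hmem.2)
  rw [setIntegral_indicator hAm]
  have hadd : ∫ ω in s ∩ A, martNoise κ v θ Y M n ω ∂P = _ :=
    integral_add (h.integrable_mart n).integrableOn (Integrable.sub h1 h2)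
  rw [hadd, h3, add_zero,
    ← setIntegral_condExp (ℱ.le n) (h.integrable_mart n) hsA,
    setIntegral_congr_ae₀ (g := 0) (ℱ.le n _ hsA).nullMeasurableSet
      ((h.condExp_mart n).mono fun ω hω _ => hω)]
  simp

end

/-! ### Step sizes and exponential bounds for the cut-off martingale noise. -/

theorem IsStepSize.summable_shift {a : ℕ → ℝ} (ha : IsStepSize a) (n₀ : ℕ) :
    Summable fun m => a (n₀ + m) ^ 2 := by
  simpa only [add_comm n₀] using (summable_nat_add_iff n₀).2 ha.summable_sq

theorem IsStepSize.tailSq_pos {a : ℕ → ℝ} (ha : IsStepSize a) (n₀ : ℕ) : 0 < tailSq a n₀ :=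
  (ha.summable_shift n₀).tsum_pos (fun _ => sq_nonneg _) 0 (pow_pos (ha.pos _) 2)

theorem IsStepSize.sum_range_le_tailSq {a : ℕ → ℝ} (ha : IsStepSize a) (n₀ n : ℕ) :
    ∑ i ∈ Finset.range n, a (n₀ + i) ^ 2 ≤ tailSq a n₀ :=
  (ha.summable_shift n₀).sum_le_tsum _ fun _ _ => sq_nonneg _

theorem IsStepSize.sum_Ico_le_tailSq {a : ℕ → ℝ} (ha : IsStepSize a) {n₀ j n : ℕ}
    (hj : n₀ ≤ j) : ∑ i ∈ Finset.Ico j n, a i ^ 2 ≤ tailSq a n₀ := by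
  refine le_trans ?_ (ha.sum_range_le_tailSq n₀ (n - n₀))
  rw [← Finset.sum_Ico_eq_sum_range (fun i => a i ^ 2)]
  exact Finset.sum_le_sum_of_subset_of_nonneg (Finset.Ico_subset_Ico_left hj)
    fun _ _ _ => sq_nonneg _

theorem IsStepSize.tendsto_tailSq {a : ℕ → ℝ} (_ha : IsStepSize a) :
    Tendsto (tailSq a) atTop (𝓝 0) := by
  refine (tendsto_sum_nat_add fun n => a n ^ 2).congr fun n => ?_
  simp only [tailSq, add_comm]

theorem IsStepSize.tendsto_zero {a : ℕ → ℝ} (ha : IsStepSize a) : Tendsto a atTop (𝓝 0) := by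
  have h := ha.summable_sq.tendsto_atTop_zero
  have h2 := (Real.continuous_sqrt.tendsto 0).comp h
  rw [Real.sqrt_zero] at h2
  exact h2.congr fun n => Real.sqrt_sq (ha.pos n).le

theorem exists_norm_martNoise_le {d k : ℕ} {f : E d → E k → E d}
    {κ : Kernel (E d × E k) (E k)} {Γ : E d → Measure (E k)} {v : E d → E k → E d}
    {K : ℝ} {L : ℝ≥0} (hK : ∀ θ y, ‖f θ y‖ ≤ K * (1 + ‖θ‖))
    (hL : LipschitzWith L (meanField f Γ))
    (hv : ∀ θ, IsPoissonSolution (Kernel.sectR κ θ) (Γ θ) (f θ) (v θ))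
    (hvreg : LocallyRegular v) (R C K' : ℝ) :
    ∃ c > 0, ∀ θ y y' m, ‖θ‖ ≤ R → ‖y‖ ≤ C → ‖y'‖ ≤ C → ‖m‖ ≤ K' * (1 + ‖θ‖) →
      ‖m + (v θ y' - ∫ z, v θ z ∂(κ (θ, y)))‖ ≤ c := by
  obtain ⟨cv, hcv, hgrow, -⟩ := hvreg (|R| + 1) (by positivity)
  refine ⟨|K'| * (1 + |R|) + 2 * (cv * (1 + |C|)) + |K| * (1 + |R|) +
    (‖meanField f Γ 0‖ + L * |R|) + 1, by positivity, ?_⟩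
  intro θ y y' m hθ hy hy' hm
  have hθ' : ‖θ‖ ≤ |R| := hθ.trans (le_abs_self R)
  -- The kernel from `y` may have unbounded support, so growth of `v` does not bound this integral
  -- directly. The Poisson equation expresses it through values at `y` alone.
  have hint : ∫ z, v θ z ∂(κ (θ, y)) = v θ y - (f θ y - meanField f Γ θ) := by
    have := (hv θ).eq y
    rw [Kernel.sectR_apply] at this
    rw [meanField, ← this]
    abel
  have h1 : ‖m‖ ≤ |K'| * (1 + |R|) := by
    refine hm.trans ((mul_le_mul_of_nonneg_right (le_abs_self K') (by positivity)).trans ?_)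
    gcongr
  have hvy : ∀ y, ‖y‖ ≤ C → ‖v θ y‖ ≤ cv * (1 + |C|) := by
    intro y hy
    refine (hgrow θ (by linarith) y).trans ?_
    have := hy.trans (le_abs_self C)
    gcongr
  have h2 := hvy y hy
  have h3 := hvy y' hy'
  have h4 : ‖f θ y‖ ≤ |K| * (1 + |R|) := by
    refine (hK θ y).trans ((mul_le_mul_of_nonneg_right (le_abs_self K) (by positivity)).trans ?_)
    gcongr
  have h5 : ‖meanField f Γ θ‖ ≤ ‖meanField f Γ 0‖ + L * |R| := by
    have e := hL.norm_sub_le θ 0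
    rw [sub_zero] at e
    have e2 := norm_sub_norm_le (meanField f Γ θ) (meanField f Γ 0)
    have e3 : (L : ℝ) * ‖θ‖ ≤ L * |R| := by gcongr
    linarith
  rw [hint]
  calc _ = ‖m + (v θ y' - v θ y) + (f θ y - meanField f Γ θ)‖ := by congr 1; abel
    _ ≤ ‖m‖ + (‖v θ y'‖ + ‖v θ y‖) + (‖f θ y‖ + ‖meanField f Γ θ‖) := by
      refine (norm_add_le _ _).trans (add_le_add ((norm_add_le _ _).trans ?_) (norm_sub_le _ _))
      gcongr
      exact norm_sub_le _ _
    _ ≤ _ := by linarith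

/-- The filtration seen from time `n₀` on. -/
def shiftFiltration {Ω : Type*} {mΩ : MeasurableSpace Ω} (ℱ : Filtration ℕ mΩ) (n₀ : ℕ) :
    Filtration ℕ mΩ where
  seq n := ℱ (n₀ + n)
  mono' _ _ hij := ℱ.mono (Nat.add_le_add_left hij n₀)
  le' n := ℱ.le (n₀ + n)

/-- The martingale part of the noise, cut off where the iterate leaves the ball of radius `R`. -/
noncomputable def cutNoise {d k : ℕ} {Ω : Type*} (κ : Kernel (E d × E k) (E k))
    (v : E d → E k → E d) (θ : ℕ → Ω → E d) (Y : ℕ → Ω → E k) (M : ℕ → Ω → E d) (a : ℕ → ℝ)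
    (R : ℝ) (n : ℕ) (ω : Ω) : E d :=
  a n • {ω | ‖θ n ω‖ ≤ R}.indicator (martNoise κ v θ Y M n) ω

/-- The cut-off event is known at time `n`, so the martingale difference property survives, while
the increments become bounded by `c * a n`. Their squares sum to at most `c ^ 2 * tailSq a n₀`. -/
theorem IsSA.measureReal_cutNoise_ge_le {d k : ℕ} (hd : 0 < d) {f : E d → E k → E d}
    {κ : Kernel (E d × E k) (E k)} [IsMarkovKernel κ] {v : E d → E k → E d} {K' C : ℝ} {a : ℕ → ℝ}
    {Ω : Type*} [mΩ : MeasurableSpace Ω] {P : Measure Ω} [IsProbabilityMeasure P]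
    {ℱ : Filtration ℕ mΩ} {θ : ℕ → Ω → E d} {Y : ℕ → Ω → E k} {M : ℕ → Ω → E d}
    (h : IsSA f κ K' C a P ℱ θ Y M) (hvreg : LocallyRegular v) (hvm : ∀ θ, Measurable (v θ))
    (ha : IsStepSize a) {R c : ℝ} (hc : 0 < c)
    (hbound : ∀ θ y y' m, ‖θ‖ ≤ R → ‖y‖ ≤ C → ‖y'‖ ≤ C → ‖m‖ ≤ K' * (1 + ‖θ‖) →
      ‖m + (v θ y' - ∫ z, v θ z ∂(κ (θ, y)))‖ ≤ c)
    {n₀ : ℕ} (hY : ∀ n ≥ n₀, ∀ᵐ ω ∂P, ‖Y n ω‖ ≤ C) {B : Set Ω} (hB : MeasurableSet[ℱ n₀] B)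
    {η : ℝ} (hη : 0 ≤ η) :
    P.real (B ∩ {ω | ∃ n, η ≤ ‖∑ i ∈ Finset.range n, cutNoise κ v θ Y M a R (n₀ + i) ω‖}) ≤
      P.real B * (2 * d * Real.exp (-(η ^ 2 / (2 * d * (c ^ 2 * tailSq a n₀))))) := by
  have hv := hvreg.measurable_uncurry hvm
  have hA : ∀ n, MeasurableSet[ℱ n] {ω | ‖θ n ω‖ ≤ R} := fun n =>
    (measurable_norm.comp (h.measurable_iterate n)) measurableSet_Iic
  have hmeas : ∀ n, Measurable[ℱ (n + 1)]
      ({ω | ‖θ n ω‖ ≤ R}.indicator (martNoise κ v θ Y M n)) := fun n =>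
    (h.measurable_martNoise hv n).indicator (ℱ.mono (Nat.le_succ n) _ (hA n))
  have hb : ∀ n ≥ n₀, ∀ᵐ ω ∂P,
      ‖{ω | ‖θ n ω‖ ≤ R}.indicator (martNoise κ v θ Y M n) ω‖ ≤ c := by
    intro n hn
    filter_upwards [hY n hn, hY (n + 1) (hn.trans (Nat.le_succ n)), h.mart_bound n]
      with ω h1 h2 h3
    by_cases hω : ω ∈ {ω | ‖θ n ω‖ ≤ R}
    · rw [indicator_of_mem hω]
      exact hbound _ _ _ _ hω h1 h2 h3
    · rw [indicator_of_notMem hω, norm_zero]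
      exact hc.le
  obtain ⟨cv, hcv, hgrow, -⟩ := hvreg (|R| + 1) (by positivity)
  have h0 : ∀ n ≥ n₀, P[{ω | ‖θ n ω‖ ≤ R}.indicator (martNoise κ v θ Y M n) | ℱ n] =ᵐ[P] 0 := by
    intro n hn
    refine h.condExp_indicator_martNoise hv (hA n) (c := cv * (1 + |C|)) ?_
      (Integrable.of_bound ((hmeas n).mono (ℱ.le _) le_rfl).aestronglyMeasurable c (hb n hn))
    filter_upwards [hY (n + 1) (hn.trans (Nat.le_succ n))] with ω h2 hω
    have hω' : ‖θ n ω‖ ≤ R := hω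
    refine (hgrow _ (by linarith [le_abs_self R]) _).trans ?_
    have := h2.trans (le_abs_self C)
    gcongr
  refine measureReal_exists_norm_partialSum_ge_le hd (𝒢 := shiftFiltration ℱ n₀)
    (X := fun i => cutNoise κ v θ Y M a R (n₀ + i)) (c := fun i => c * a (n₀ + i))
    (fun n => (hmeas (n₀ + n)).const_smul (a (n₀ + n))) (fun n => ?_) (fun n => ?_) hB
    (mul_pos (pow_pos hc 2) (ha.tailSq_pos n₀)) hη (fun n => ?_)
  · filter_upwards [hb (n₀ + n) (Nat.le_add_right _ _)] with ω hω
    rw [cutNoise, norm_smul, Real.norm_of_nonneg (ha.pos _).le, mul_comm]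
    exact mul_le_mul_of_nonneg_right hω (ha.pos _).le
  · have h1 := condExp_smul (μ := P) (a (n₀ + n))
      ({ω | ‖θ (n₀ + n) ω‖ ≤ R}.indicator (martNoise κ v θ Y M (n₀ + n))) (ℱ (n₀ + n))
    filter_upwards [h1, h0 (n₀ + n) (Nat.le_add_right _ _)] with ω h1 h2
    refine h1.trans ?_
    simp [h2]
  · simp only [mul_pow]
    rw [← Finset.mul_sum]
    exact mul_le_mul_of_nonneg_left (ha.sum_range_le_tailSq n₀ n) (sq_nonneg c)

/-! ### Summation by parts for the Poisson correction. -/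

/-- Abel summation leaves boundary terms, the variation of the step sizes (which telescopes by
monotonicity) and the changes of `v_θ` in `θ`, each of order `a m ^ 2`. -/
theorem norm_sum_poisson_diff_le {d k : ℕ} {v : E d → E k → E d} {a : ℕ → ℝ} (ha : IsStepSize a)
    {R C cv F : ℝ} (hcv : 0 < cv) (hF : 0 ≤ F)
    (hgrow : ∀ θ, ‖θ‖ ≤ R → ∀ y, ‖v θ y‖ ≤ cv * (1 + ‖y‖))
    (hlip : ∀ θ θ', ‖θ‖ ≤ R → ‖θ'‖ ≤ R → ∀ y, ‖v θ y - v θ' y‖ ≤ cv * ‖θ - θ'‖ * (1 + ‖y‖))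
    {θ : ℕ → E d} {Y : ℕ → E k} {j n : ℕ} (hY : ∀ m ≥ j, ‖Y m‖ ≤ C)
    (hθ : ∀ m, j ≤ m → m < n → ‖θ m‖ ≤ R)
    (hinc : ∀ m, j ≤ m → m < n → ‖θ (m + 1) - θ m‖ ≤ F * a m) :
    ‖∑ m ∈ Finset.Ico j n, a m • (v (θ m) (Y m) - v (θ m) (Y (m + 1)))‖ ≤
      cv * (1 + C) * (2 * a j + F * ∑ m ∈ Finset.Ico j n, a m ^ 2) := by
  have hC : 0 ≤ C := (norm_nonneg _).trans (hY j le_rfl)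
  set c₁ := cv * (1 + C) with hc₁
  have hc₁0 : 0 ≤ c₁ := by positivity
  have hvb : ∀ m m', j ≤ m → m < n → j ≤ m' → ‖v (θ m) (Y m')‖ ≤ c₁ := by
    intro m m' hm hmn hm'
    refine (hgrow _ (hθ m hm hmn) _).trans ?_
    rw [hc₁]; gcongr; exact hY m' hm'
  -- Adding the last boundary term makes the sum telescope. The squares stop one index earlier than
  -- the sum, so that `θ n`, whose norm is not controlled, never enters.
  have key : ∀ i, j + i < n →
      ‖∑ m ∈ Finset.Ico j (j + i + 1), a m • (v (θ m) (Y m) - v (θ m) (Y (m + 1))) +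
        a (j + i) • v (θ (j + i)) (Y (j + i + 1))‖ ≤
      c₁ * (2 * a j - a (j + i) + F * ∑ m ∈ Finset.Ico j (j + i), a m ^ 2) := by
    intro i
    induction i with
    | zero =>
      intro hi
      simp only [add_zero, Nat.Ico_succ_singleton, Finset.sum_singleton, smul_sub, sub_add_cancel,
        Finset.Ico_self, Finset.sum_empty, mul_zero]
      rw [norm_smul, Real.norm_of_nonneg (ha.pos _).le]
      have := mul_le_mul_of_nonneg_left (hvb j j le_rfl hi le_rfl) (ha.pos j).le
      linarith
    | succ i ih =>
      intro hi
      have hi' : j + i < n := by omega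
      specialize ih hi'
      set m := j + i with hm
      have e : j + (i + 1) = m + 1 := by omega
      rw [e] at hi ⊢
      rw [Finset.sum_Ico_succ_top (by omega : j ≤ m + 1),
        Finset.sum_Ico_succ_top (by omega : j ≤ m) fun i => a i ^ 2]
      set S := ∑ i ∈ Finset.Ico j (m + 1), a i • (v (θ i) (Y i) - v (θ i) (Y (i + 1)))
      have e2 : S + a (m + 1) • (v (θ (m + 1)) (Y (m + 1)) - v (θ (m + 1)) (Y (m + 1 + 1))) +
          a (m + 1) • v (θ (m + 1)) (Y (m + 1 + 1)) =
          (S + a m • v (θ m) (Y (m + 1))) +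
          ((a (m + 1) - a m) • v (θ (m + 1)) (Y (m + 1)) +
            a m • (v (θ (m + 1)) (Y (m + 1)) - v (θ m) (Y (m + 1)))) := by
        module
      rw [e2]
      refine (norm_add_le _ _).trans ((add_le_add ih (norm_add_le _ _)).trans ?_)
      have h1 : ‖(a (m + 1) - a m) • v (θ (m + 1)) (Y (m + 1))‖ ≤ (a m - a (m + 1)) * c₁ := by
        have hanti := ha.antitone (Nat.le_succ m)
        rw [norm_smul, Real.norm_of_nonpos (by simpa using hanti)]
        have := mul_le_mul_of_nonneg_left
          (hvb (m + 1) (m + 1) (by omega) hi (by omega)) (sub_nonneg.2 hanti)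
        simpa using this
      have h2 : ‖a m • (v (θ (m + 1)) (Y (m + 1)) - v (θ m) (Y (m + 1)))‖ ≤
          c₁ * (F * a m ^ 2) := by
        rw [norm_smul, Real.norm_of_nonneg (ha.pos _).le]
        have hl := hlip (θ (m + 1)) (θ m) (hθ _ (by omega) hi) (hθ _ (by omega) hi') (Y (m + 1))
        have hi2 := hinc m (by omega) hi'
        have hy := hY (m + 1) (by omega)
        calc _ ≤ a m * (cv * (F * a m) * (1 + C)) := by
              refine mul_le_mul_of_nonneg_left (hl.trans ?_) (ha.pos m).le
              have := (ha.pos m).le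
              gcongr
          _ = _ := by rw [hc₁]; ring
      linarith
  rcases le_or_gt n j with hnj | hnj
  · rw [Finset.Ico_eq_empty (by omega)]
    simp only [Finset.sum_empty, norm_zero, mul_zero, add_zero]
    have := (ha.pos j).le
    positivity
  · obtain ⟨i, rfl⟩ : ∃ i, n = j + i + 1 := ⟨n - j - 1, by omega⟩
    have h1 := key i (by omega)
    have h2 : ‖a (j + i) • v (θ (j + i)) (Y (j + i + 1))‖ ≤ a (j + i) * c₁ := by
      rw [norm_smul, Real.norm_of_nonneg (ha.pos _).le]
      exact mul_le_mul_of_nonneg_left (hvb _ _ (by omega) (by omega) (by omega)) (ha.pos _).le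
    have h3 := norm_sub_le
      (∑ m ∈ Finset.Ico j (j + i + 1), a m • (v (θ m) (Y m) - v (θ m) (Y (m + 1))) +
        a (j + i) • v (θ (j + i)) (Y (j + i + 1))) (a (j + i) • v (θ (j + i)) (Y (j + i + 1)))
    rw [add_sub_cancel_right] at h3
    rw [Finset.sum_Ico_succ_top (by omega : j ≤ j + i) fun i => a i ^ 2]
    have h4 : 0 ≤ c₁ * (F * a (j + i) ^ 2) := by positivity
    linarith

/-! ### The flow: Lyapunov stability, uniform attraction and Euler approximation. -/

section Flow

variable {d : ℕ} {h : E d → E d} {x y : ℝ → E d}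

theorem hasDerivWithinAt_Ici_of_integralCurve (hx : IsIntegralCurveOn x (fun _ => h) (Ici 0))
    {t : ℝ} (ht : 0 ≤ t) : HasDerivWithinAt x (h (x t)) (Ici t) t :=
  (hx t ht).mono (Ici_subset_Ici.2 ht)

theorem continuousOn_of_integralCurve (hx : IsIntegralCurveOn x (fun _ => h) (Ici 0)) :
    ContinuousOn x (Ici 0) := fun t ht => (hx t ht).continuousWithinAt

theorem hasDerivAt_of_integralCurve (hx : IsIntegralCurveOn x (fun _ => h) (Ici 0))
    {t : ℝ} (ht : 0 < t) : HasDerivAt x (h (x t)) t :=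
  (hx t ht.le).hasDerivAt (Ici_mem_nhds ht)

theorem dist_integralCurve_le {L : ℝ≥0} (hL : LipschitzWith L h)
    (hx : IsIntegralCurveOn x (fun _ => h) (Ici 0))
    (hy : IsIntegralCurveOn y (fun _ => h) (Ici 0)) {t : ℝ} (ht : 0 ≤ t) :
    dist (x t) (y t) ≤ dist (x 0) (y 0) * Real.exp (L * t) := by
  have := dist_le_of_trajectories_ODE (v := fun _ => h) (K := L) (a := 0) (b := t)
    (fun _ => hL) ((continuousOn_of_integralCurve hx).mono Icc_subset_Ici_self)
    (fun s hs => hasDerivWithinAt_Ici_of_integralCurve hx hs.1)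
    ((continuousOn_of_integralCurve hy).mono Icc_subset_Ici_self)
    (fun s hs => hasDerivWithinAt_Ici_of_integralCurve hy hs.1) le_rfl t ⟨ht, le_rfl⟩
  simpa using this

theorem norm_integralCurve_le {L : ℝ≥0} (hL : LipschitzWith L h)
    (hx : IsIntegralCurveOn x (fun _ => h) (Ici 0)) {r : ℝ} (hr : ‖x 0‖ ≤ r) {t T : ℝ}
    (ht : 0 ≤ t) (htT : t ≤ T) : ‖x t‖ ≤ gronwallBound r L ‖h 0‖ T := by
  have h1 := norm_le_gronwallBound_of_norm_deriv_right_le (f := x) (f' := fun s => h (x s))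
    (K := L) (ε := ‖h 0‖) (a := 0) (b := t)
    ((continuousOn_of_integralCurve hx).mono Icc_subset_Ici_self)
    (fun s hs => hasDerivWithinAt_Ici_of_integralCurve hx hs.1) hr
    (fun s _ => by
      have e := hL.norm_sub_le (x s) 0
      rw [sub_zero] at e
      linarith [norm_sub_norm_le (h (x s)) (h 0)]) t ⟨ht, le_rfl⟩
  rw [sub_zero] at h1
  exact h1.trans (gronwallBound_mono ((norm_nonneg _).trans hr) (norm_nonneg _) L.2 htT)

variable {G H : Set (E d)} {V : E d → ℝ}

theorem antitoneOn_lyapunov (hV : IsStrictLyapunov h G H V)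
    (hx : IsIntegralCurveOn x (fun _ => h) (Ici 0)) {s t : ℝ} (hs : 0 ≤ s)
    (hG : ∀ u ∈ Icc s t, x u ∈ G) : AntitoneOn (fun u => V (x u)) (Icc s t) := by
  have hd : ∀ u ∈ interior (Icc s t),
      HasDerivAt (fun u => V (x u)) (inner ℝ (gradient V (x u)) (h (x u))) u := by
    intro u hu
    rw [interior_Icc] at hu
    have hVd : DifferentiableAt ℝ V (x u) :=
      hV.differentiableOn.differentiableAt (hV.isOpen.mem_nhds (hG u (Ioo_subset_Icc_self hu)))
    exact hVd.hasGradientAt.hasFDerivAt.comp_hasDerivAt u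
      (hasDerivAt_of_integralCurve hx (hs.trans_lt hu.1))
  refine antitoneOn_of_deriv_nonpos (convex_Icc s t) ?_ ?_ ?_
  · exact hV.differentiableOn.continuousOn.comp
      ((continuousOn_of_integralCurve hx).mono fun u hu => hs.trans hu.1) hG
  · exact fun u hu => (hd u hu).differentiableAt.differentiableWithinAt
  · intro u hu
    rw [(hd u hu).deriv]
    exact hV.inner_nonpos _ (hG u (interior_subset hu))

/-- To leave the neighbourhood, the curve would first have to hit the sphere at distance `r`, where
`V ≥ c`; but `V` starts below `c` and does not increase up to then. -/
theorem infDist_lt_of_lyapunov (hV : IsStrictLyapunov h G H V)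
    (hx : IsIntegralCurveOn x (fun _ => h) (Ici 0)) {r c : ℝ}
    (hrG : {z | Metric.infDist z H ≤ r} ⊆ G) (hc : ∀ z, Metric.infDist z H = r → c ≤ V z)
    {s t : ℝ} (hs : 0 ≤ s) (hst : s ≤ t) (hsr : Metric.infDist (x s) H < r) (hsc : V (x s) < c) :
    Metric.infDist (x t) H < r := by
  by_contra! hcon
  set g : ℝ → ℝ := fun u => Metric.infDist (x u) H with hg
  have hgc : ContinuousOn g (Icc s t) :=
    (Metric.continuous_infDist_pt H).comp_continuousOn
      ((continuousOn_of_integralCurve hx).mono fun u hu => hs.trans hu.1)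
  have hivt : ∀ u ∈ Icc s t, r ≤ g u → ∃ w ∈ Icc s u, g w = r := fun u hu hru =>
    intermediate_value_Icc hu.1 (hgc.mono (Icc_subset_Icc_right hu.2)) ⟨hsr.le, hru⟩
  have hcomp : IsCompact (Icc s t ∩ g ⁻¹' {r}) :=
    isCompact_Icc.of_isClosed_subset (hgc.preimage_isClosed_of_isClosed isClosed_Icc
      isClosed_singleton) inter_subset_left
  obtain ⟨w₀, hw₀, hw₀r⟩ := hivt t ⟨hst, le_rfl⟩ hcon
  obtain ⟨w, ⟨hw, hwr⟩, hmin⟩ := hcomp.exists_isLeast ⟨w₀, hw₀, hw₀r⟩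
  have hwr' : g w = r := hwr
  have hin : ∀ u ∈ Icc s w, x u ∈ G := by
    intro u hu
    refine hrG ?_
    change g u ≤ r
    rcases eq_or_lt_of_le hu.2 with rfl | hlt
    · exact hwr'.le
    · by_contra! hgt
      obtain ⟨w', hw', hw'r⟩ := hivt u ⟨hu.1, hu.2.trans hw.2⟩ hgt.le
      have := hmin ⟨⟨hw'.1, (hw'.2.trans hu.2).trans hw.2⟩, hw'r⟩
      linarith [hw'.2]
  have hV1 := antitoneOn_lyapunov hV hx hs hin ⟨le_rfl, hw.1⟩ ⟨hw.1, le_rfl⟩ hw.1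
  have hV2 := hc (x w) hwr'
  simp only at hV1
  linarith

/-- Attraction brings each trajectory into an open set that traps it near `H`. Continuous dependence
on the initial point makes the entry time locally uniform, and compactness of `D` makes it uniform.
-/
theorem exists_time_forall_mem_thickening {L : ℝ≥0} (hL : LipschitzWith L h)
    (hV : IsStrictLyapunov h G H V) (hne : H.Nonempty) {D : Set (E d)} (hD : IsCompact D)
    (hattr : D ⊆ domainOfAttraction h H) {ε : ℝ} (hε : 0 < ε)
    (hεG : Metric.thickening ε H ⊆ G) :
    ∃ T ≥ (1 : ℝ), ∀ x, x 0 ∈ D → IsIntegralCurveOn x (fun _ => h) (Ici 0) →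
      ∀ t ≥ T, x t ∈ Metric.thickening ε H := by
  set r := ε / 2 with hr
  have hr0 : 0 < r := by positivity
  have hrG : {z | Metric.infDist z H ≤ r} ⊆ G := fun z hz =>
    hεG ((Metric.mem_thickening_iff_infDist_lt hne).2 (lt_of_le_of_lt hz (by linarith)))
  have hVc : ContinuousOn V G := hV.differentiableOn.continuousOn
  have hsph : IsCompact {z | Metric.infDist z H = r} := by
    refine (hV.isCompact.cthickening (r := ε)).of_isClosed_subset
      (isClosed_eq (Metric.continuous_infDist_pt H) continuous_const) fun z hz => ?_
    have hz' : Metric.infDist z H = r := hz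
    exact Metric.thickening_subset_cthickening _ _
      ((Metric.mem_thickening_iff_infDist_lt hne).2 (by rw [hz']; linarith))
  -- `V` is positive on this compact sphere because its zeros in `G` all lie in `H`.
  obtain ⟨c, hc0, hc⟩ := hsph.exists_forall_le' (hVc.mono fun z hz => hrG (le_of_eq hz))
    (a := 0) (fun z hz => by
      refine lt_of_le_of_ne (hV.nonneg z (hrG (le_of_eq hz))) fun h0 => ?_
      have hzH : z ∈ H := by
        rw [hV.zero_set]; exact ⟨hrG (le_of_eq hz), h0.symm⟩
      have hz' : Metric.infDist z H = r := hz
      rw [Metric.infDist_zero_of_mem hzH] at hz'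
      exact hr0.ne hz')
  set U : Set (E d) := {z | Metric.infDist z H < r} ∩ (G ∩ V ⁻¹' Iio c) with hU
  have hUo : IsOpen U :=
    (isOpen_lt (Metric.continuous_infDist_pt H) continuous_const).inter
      (hVc.isOpen_inter_preimage hV.isOpen isOpen_Iio)
  have hHU : H ⊆ U := by
    intro z hz
    have hz' := hz
    rw [hV.zero_set] at hz'
    refine ⟨?_, hz'.1, ?_⟩
    · change Metric.infDist z H < r
      rw [Metric.infDist_zero_of_mem hz]; exact hr0
    · change V z < c
      rw [hz'.2]; exact hc0
  have hstay : ∀ x, IsIntegralCurveOn x (fun _ => h) (Ici 0) → ∀ s, 0 ≤ s → x s ∈ U →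
      ∀ t, s ≤ t → x t ∈ Metric.thickening ε H := by
    intro x hx s hs hsU t hst
    rw [Metric.mem_thickening_iff_infDist_lt hne]
    have := infDist_lt_of_lyapunov hV hx hrG (fun z hz => hc z hz) hs hst hsU.1 hsU.2.2
    linarith
  have hloc : ∀ θ ∈ D, ∃ W ∈ 𝓝[D] θ, ∃ T ≥ (1 : ℝ), ∀ x, x 0 ∈ W →
      IsIntegralCurveOn x (fun _ => h) (Ici 0) → ∀ t ≥ T, x t ∈ Metric.thickening ε H := by
    intro θ hθ
    obtain ⟨x, rfl, hx, hlim⟩ := hattr hθ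
    obtain ⟨T, hT, hT1⟩ := ((hlim.eventually (hUo.mem_nhdsSet.2 hHU)).and
      (eventually_ge_atTop (1 : ℝ))).exists
    have hT0 : 0 ≤ T := by linarith
    obtain ⟨ρ, hρ, hρU⟩ := Metric.isOpen_iff.1 hUo (x T) hT
    refine ⟨Metric.ball (x 0) (ρ / Real.exp (L * T)),
      mem_nhdsWithin_of_mem_nhds (Metric.ball_mem_nhds _ (by positivity)), T, hT1, ?_⟩
    intro y hy0 hy t ht
    refine hstay y hy T hT0 (hρU ?_) t ht
    rw [Metric.mem_ball] at hy0 ⊢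
    refine (dist_integralCurve_le hL hy hx hT0).trans_lt ?_
    rwa [lt_div_iff₀ (Real.exp_pos _)] at hy0
  refine hD.induction_on (p := fun W => ∃ T ≥ (1 : ℝ), ∀ x, x 0 ∈ W →
    IsIntegralCurveOn x (fun _ => h) (Ici 0) → ∀ t ≥ T, x t ∈ Metric.thickening ε H) ?_ ?_ ?_ hloc
  · exact ⟨1, le_rfl, fun x hx => absurd hx (notMem_empty _)⟩
  · rintro s t hst ⟨T, hT1, hT⟩
    exact ⟨T, hT1, fun x hx => hT x (hst hx)⟩
  · rintro s t ⟨T, hT1, hT⟩ ⟨T', hT1', hT'⟩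
    refine ⟨max T T', le_max_of_le_left hT1, fun x hx0 hx u hu => ?_⟩
    rcases hx0 with hx0 | hx0
    · exact hT x hx0 hx u ((le_max_left _ _).trans hu)
    · exact hT' x hx0 hx u ((le_max_right _ _).trans hu)

theorem norm_integralCurve_step_le {L : ℝ≥0} (hL : LipschitzWith L h)
    (hx : IsIntegralCurveOn x (fun _ => h) (Ici 0)) {T Ch : ℝ}
    (hCh : ∀ t ∈ Icc 0 T, ‖h (x t)‖ ≤ Ch) {s u : ℝ} (hs : 0 ≤ s) (hu : 0 ≤ u) (hT : s + u ≤ T) :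
    ‖x (s + u) - x s - u • h (x s)‖ ≤ L * Ch * u ^ 2 := by
  have hder : ∀ w ∈ Icc s (s + u), HasDerivWithinAt x (h (x w)) (Icc s (s + u)) w := fun w hw =>
    (hx w (hs.trans hw.1)).mono fun z hz => hs.trans hz.1
  have h1 := norm_image_sub_le_of_norm_deriv_le_segment' hder
    (fun w hw => hCh w ⟨hs.trans hw.1, hw.2.le.trans hT⟩)
  have hCh0 : 0 ≤ Ch := (norm_nonneg _).trans (hCh s ⟨hs, by linarith⟩)
  have h2 := norm_image_sub_le_of_norm_deriv_le_segment' (f := fun w => x w - w • h (x s))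
    (f' := fun w => h (x w) - h (x s)) (C := L * (Ch * u)) (a := s) (b := s + u)
    (fun w hw => by
      have := (hder w hw).sub ((hasDerivWithinAt_id w (Icc s (s + u))).smul_const (h (x s)))
      rw [one_smul] at this
      exact this)
    (fun w hw => by
      refine (hL.norm_sub_le _ _).trans ?_
      have := h1 w ⟨hw.1, hw.2.le⟩
      have hwu : w - s ≤ u := by linarith [hw.2]
      gcongr
      exact this.trans (by gcongr))
    (s + u) ⟨by linarith, le_rfl⟩
  calc _ = ‖x (s + u) - (s + u) • h (x s) - (x s - s • h (x s))‖ := by congr 1; module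
    _ ≤ _ := h2
    _ = _ := by ring

/-- Subtracting the accumulated noise `w` from `θ` leaves an Euler scheme perturbed only inside `h`.
Noise thus enters through its partial sums, not the sum of its norms, and discrete Gronwall applies.
-/
theorem norm_sub_integralCurve_le {L : ℝ≥0} (hL : LipschitzWith L h)
    (hx : IsIntegralCurveOn x (fun _ => h) (Ici 0)) {T Ch : ℝ}
    (hCh : ∀ t ∈ Icc 0 T, ‖h (x t)‖ ≤ Ch) {a : ℕ → ℝ} (ha : ∀ n, 0 ≤ a n) {θ : ℕ → E d}
    (h0 : θ 0 = x 0) {N : ℕ} (hN : timeOf a N ≤ T) {η : ℝ}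
    (hη : ∀ n ≤ N, ‖∑ m ∈ Finset.range n, (θ (m + 1) - θ m - a m • h (θ m))‖ ≤ η) :
    ‖θ N - x (timeOf a N)‖ ≤
      η + (L * η * T + L * Ch * ∑ m ∈ Finset.range N, a m ^ 2) * Real.exp (L * T) := by
  set w : ℕ → E d := fun n => ∑ m ∈ Finset.range n, (θ (m + 1) - θ m - a m • h (θ m)) with hw
  have hη0 : 0 ≤ η := (norm_nonneg _).trans (hη 0 (Nat.zero_le _))
  have htnn : ∀ n, 0 ≤ timeOf a n := fun n => Finset.sum_nonneg fun m _ => ha m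
  have htmono : Monotone (timeOf a) := monotone_nat_of_le_succ fun n => by
    rw [timeOf, timeOf, Finset.sum_range_succ]; linarith [ha n]
  have hCh0 : 0 ≤ Ch := (norm_nonneg _).trans (hCh 0 ⟨le_rfl, (htnn N).trans hN⟩)
  have key : ∀ n ≤ N, ‖θ n - w n - x (timeOf a n)‖ ≤
      (L * η * timeOf a n + L * Ch * ∑ m ∈ Finset.range n, a m ^ 2) *
        Real.exp (L * timeOf a n) := by
    intro n
    induction n with
    | zero => intro _; simp [hw, timeOf, h0]
    | succ n ih =>
      intro hn
      have hn' : n ≤ N := by omega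
      specialize ih hn'
      have ht : timeOf a (n + 1) = timeOf a n + a n := Finset.sum_range_succ _ _
      have hws : w (n + 1) = w n + (θ (n + 1) - θ n - a n • h (θ n)) := Finset.sum_range_succ _ _
      have hstep := norm_integralCurve_step_le hL hx hCh (htnn n) (ha n)
        (ht ▸ (htmono hn).trans hN)
      have hdec : θ (n + 1) - w (n + 1) - x (timeOf a (n + 1)) =
          (θ n - w n - x (timeOf a n)) + a n • (h (θ n) - h (x (timeOf a n))) -
            (x (timeOf a n + a n) - x (timeOf a n) - a n • h (x (timeOf a n))) := by
        rw [hws, ht]; module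
      have hlip : ‖a n • (h (θ n) - h (x (timeOf a n)))‖ ≤
          a n * (L * (‖θ n - w n - x (timeOf a n)‖ + η)) := by
        rw [norm_smul, Real.norm_of_nonneg (ha n)]
        refine mul_le_mul_of_nonneg_left ((hL.norm_sub_le _ _).trans ?_) (ha n)
        refine mul_le_mul_of_nonneg_left ?_ L.2
        calc _ = ‖(θ n - w n - x (timeOf a n)) + w n‖ := by congr 1; abel
          _ ≤ _ := (norm_add_le _ _).trans (add_le_add le_rfl (hη n hn'))
      set u := ‖θ n - w n - x (timeOf a n)‖
      set t := timeOf a n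
      set Sq := ∑ m ∈ Finset.range n, a m ^ 2
      rw [hdec, Finset.sum_range_succ, ht]
      have hle : u + a n * (L * (u + η)) + L * Ch * a n ^ 2 ≤
          (L * η * (t + a n) + L * Ch * (Sq + a n ^ 2)) * Real.exp (L * (t + a n)) := by
        have hL0 : (0 : ℝ) ≤ L := L.2
        have han := ha n
        have ht0 := htnn n
        have he1 : 1 + L * a n ≤ Real.exp (L * a n) := by
          linarith [Real.add_one_le_exp (L * a n)]
        have he2 : 1 ≤ Real.exp (L * (t + a n)) := Real.one_le_exp (by positivity)
        have he3 : Real.exp (L * (t + a n)) = Real.exp (L * t) * Real.exp (L * a n) := by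
          rw [← Real.exp_add]; ring_nf
        have hA : 0 ≤ L * η * t + L * Ch * Sq := by positivity
        have hB : 0 ≤ L * η * a n + L * Ch * a n ^ 2 := by positivity
        calc _ = (1 + L * a n) * u + (L * η * a n + L * Ch * a n ^ 2) := by ring
          _ ≤ Real.exp (L * a n) * ((L * η * t + L * Ch * Sq) * Real.exp (L * t)) +
              (L * η * a n + L * Ch * a n ^ 2) * Real.exp (L * (t + a n)) := by
            refine add_le_add (mul_le_mul he1 ih (norm_nonneg _) (Real.exp_pos _).le) ?_
            exact le_mul_of_one_le_right hB he2
          _ = _ := by rw [he3]; ring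
      refine le_trans ?_ hle
      exact (norm_sub_le _ _).trans (add_le_add ((norm_add_le _ _).trans
        (add_le_add le_rfl hlip)) hstep)
  have hS : 0 ≤ ∑ m ∈ Finset.range N, a m ^ 2 := Finset.sum_nonneg fun _ _ => sq_nonneg _
  calc _ = ‖w N + (θ N - w N - x (timeOf a N))‖ := by congr 1; abel
    _ ≤ η + (L * η * timeOf a N + L * Ch * ∑ m ∈ Finset.range N, a m ^ 2) *
        Real.exp (L * timeOf a N) :=
      (norm_add_le _ _).trans (add_le_add (hη N le_rfl) (key N le_rfl))
    _ ≤ _ := by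
      have hT0 : 0 ≤ T := (htnn N).trans hN
      gcongr

end Flow

/-! ### The time grid and the trapping argument. -/

theorem timeOf_succ (a : ℕ → ℝ) (n : ℕ) : timeOf a (n + 1) = timeOf a n + a n :=
  Finset.sum_range_succ _ _

theorem timeOf_shift (a : ℕ → ℝ) {j n : ℕ} (hjn : j ≤ n) :
    timeOf (fun m => a (j + m)) (n - j) = timeOf a n - timeOf a j := by
  rw [timeOf, timeOf, timeOf, ← Finset.sum_Ico_eq_sum_range a, Finset.sum_Ico_eq_sub _ hjn]

theorem IsStepSize.strictMono_timeOf {a : ℕ → ℝ} (ha : IsStepSize a) : StrictMono (timeOf a) :=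
  strictMono_nat_of_lt_succ fun n => by rw [timeOf_succ]; linarith [ha.pos n]

theorem IsStepSize.tendsto_timeOf {a : ℕ → ℝ} (ha : IsStepSize a) :
    Tendsto (timeOf a) atTop atTop :=
  (not_summable_iff_tendsto_nat_atTop_of_nonneg fun n => (ha.pos n).le).1 ha.not_summable

/-- A perturbed Euler scheme whose accumulated noise is small follows the flow over a bounded time
horizon, returns to `B`, and is therefore trapped. -/
theorem norm_le_and_mem_thickening_of_noise_le {d : ℕ} {h : E d → E d} {L : ℝ≥0}
    (hL : LipschitzWith L h) {B A : Set (E d)} {T Rx : ℝ} (hT : 1 ≤ T)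
    (hflow : ∀ θ₀ ∈ B, ∃ x : ℝ → E d, x 0 = θ₀ ∧ IsIntegralCurveOn x (fun _ => h) (Ici 0) ∧
      (∀ t ∈ Icc 0 (2 * T + 2), ‖x t‖ ≤ Rx) ∧ ∀ t ≥ T, x t ∈ A)
    {δ R : ℝ} (hδA : Metric.thickening δ A ⊆ B) (hR : Rx + δ ≤ R)
    {a : ℕ → ℝ} (ha : IsStepSize a) {n₁ : ℕ} (ha1 : ∀ n ≥ n₁, a n ≤ 1) {θ : ℕ → E d}
    (hθB : θ n₁ ∈ B) {η : ℝ}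
    (hη : ∀ j n, n₁ ≤ j → j ≤ n → (∀ m, j ≤ m → m < n → ‖θ m‖ ≤ R) →
      ‖∑ m ∈ Finset.Ico j n, (θ (m + 1) - θ m - a m • h (θ m))‖ ≤ η)
    (hsmall : η + (L * η * (2 * T + 2) + L * (‖h 0‖ + L * Rx) * tailSq a n₁) *
      Real.exp (L * (2 * T + 2)) < δ) {n : ℕ} (hn : n₁ ≤ n) :
    ‖θ n‖ ≤ R ∧ (T ≤ timeOf a n - timeOf a n₁ → θ n ∈ Metric.thickening δ A) := by
  have hmono := ha.strictMono_timeOf.monotone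
  -- One window of length `2 * T + 2`. The norm bound is assumed only before `n` and proved at `n`,
  -- which lets strong induction close the circularity between boundedness and small noise.
  have local_claim : ∀ n j, n₁ ≤ j → j ≤ n → θ j ∈ B → timeOf a n - timeOf a j ≤ 2 * T + 2 →
      (∀ m, j ≤ m → m < n → ‖θ m‖ ≤ R) →
      ‖θ n‖ ≤ R ∧ (T ≤ timeOf a n - timeOf a j → θ n ∈ Metric.thickening δ A) := by
    intro n j hj hjn hjB htime hbd
    obtain ⟨x, hx0, hx, hxb, hxA⟩ := hflow _ hjB
    have hCh : ∀ t ∈ Icc 0 (2 * T + 2), ‖h (x t)‖ ≤ ‖h 0‖ + L * Rx := by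
      intro t ht
      have e := hL.norm_sub_le (x t) 0
      rw [sub_zero] at e
      have e2 : (L : ℝ) * ‖x t‖ ≤ L * Rx := mul_le_mul_of_nonneg_left (hxb t ht) L.2
      linarith [norm_sub_norm_le (h (x t)) (h 0)]
    have htube := norm_sub_integralCurve_le hL hx hCh (a := fun m => a (j + m))
      (fun m => (ha.pos _).le) (θ := fun m => θ (j + m)) hx0.symm (N := n - j)
      (by rwa [timeOf_shift a hjn]) (η := η) (fun m hm => by
        have := hη j (j + m) hj (by omega) (fun i hi him => hbd i hi (by omega))
        rwa [Finset.sum_Ico_eq_sum_range, Nat.add_sub_cancel_left] at this)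
    have hsq : ∑ m ∈ Finset.range (n - j), a (j + m) ^ 2 ≤ tailSq a n₁ := by
      rw [← Finset.sum_Ico_eq_sum_range (fun m => a m ^ 2)]
      exact ha.sum_Ico_le_tailSq hj
    have hCh0 : 0 ≤ ‖h 0‖ + L * Rx :=
      (norm_nonneg _).trans (hCh 0 ⟨le_rfl, by linarith⟩)
    rw [timeOf_shift a hjn, Nat.add_sub_cancel' hjn] at htube
    have hlt : ‖θ n - x (timeOf a n - timeOf a j)‖ < δ := by
      refine lt_of_le_of_lt (htube.trans ?_) hsmall
      gcongr
    have ht0 : 0 ≤ timeOf a n - timeOf a j := sub_nonneg.2 (hmono hjn)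
    refine ⟨?_, fun hTt => ?_⟩
    · have h1 := hxb _ ⟨ht0, htime⟩
      linarith [norm_sub_norm_le (θ n) (x (timeOf a n - timeOf a j))]
    · exact Metric.mem_thickening_iff.2 ⟨_, hxA _ hTt, by rwa [dist_eq_norm]⟩
  induction n using Nat.strong_induction_on with
  | _ n ih =>
    rcases le_or_gt (timeOf a n - timeOf a n₁) (2 * T + 2) with hle | hgt
    · exact local_claim n n₁ le_rfl hn hθB hle fun m hm hmn => (ih m hmn hm).1
    · classical
      -- Restart index: the least `j` within time `T + 1` of `n`. Since steps are at most `1`, the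
      -- elapsed time from `j` to `n` is at least `T`. More than `T + 1` has passed between `n₁` and
      -- `j`, so induction puts `θ j` in `B`.
      have hex : ∃ j, timeOf a n - timeOf a j ≤ T + 1 := ⟨n, by rw [sub_self]; linarith⟩
      set j := Nat.find hex with hj
      have hj1 : timeOf a n - timeOf a j ≤ T + 1 := Nat.find_spec hex
      have hjn₁ : n₁ < j := by
        by_contra! hcon
        have := hmono hcon
        linarith
      have hj2 : T + 1 < timeOf a n - timeOf a (j - 1) :=
        not_le.1 (Nat.find_min hex (by omega : j - 1 < j))
      have hj3 : timeOf a j = timeOf a (j - 1) + a (j - 1) := by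
        rw [← timeOf_succ]; congr 1; omega
      have hj4 := ha1 (j - 1) (by omega)
      have hTj : T ≤ timeOf a n - timeOf a j := by linarith
      have hjn : j < n := by
        by_contra! hcon
        have := hmono hcon
        linarith
      have hjB : θ j ∈ B := hδA ((ih j hjn hjn₁.le).2 (by linarith))
      obtain ⟨h1, h2⟩ := local_claim n j hjn₁.le hjn.le hjB (by linarith)
        fun m hm hmn => (ih m hmn (hjn₁.le.trans hm)).1
      exact ⟨h1, fun _ => h2 hTj⟩

/-! ### From the iterates to their interpolation. -/

theorem IsStepSize.timeIndex_spec {a : ℕ → ℝ} (ha : IsStepSize a) {t : ℝ} (ht : 0 ≤ t) :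
    timeOf a (timeIndex a t) ≤ t ∧ t < timeOf a (timeIndex a t + 1) := by
  have hbdd : BddAbove {n : ℕ | timeOf a n ≤ t} := by
    obtain ⟨N, hN⟩ := (ha.tendsto_timeOf.eventually (eventually_gt_atTop t)).exists
    refine ⟨N, fun n hn => ?_⟩
    by_contra! hlt
    have hn' : timeOf a n ≤ t := hn
    linarith [ha.strictMono_timeOf hlt]
  have hne : {n : ℕ | timeOf a n ≤ t}.Nonempty := ⟨0, by simpa [timeOf] using ht⟩
  refine ⟨Nat.sSup_mem hne hbdd, ?_⟩
  by_contra! hle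
  have : timeIndex a t + 1 ≤ timeIndex a t := le_csSup hbdd hle
  omega

theorem IsStepSize.tendsto_timeIndex {a : ℕ → ℝ} (ha : IsStepSize a) :
    Tendsto (timeIndex a) atTop atTop := by
  refine tendsto_atTop.2 fun N => ?_
  filter_upwards [eventually_ge_atTop (0 : ℝ), eventually_ge_atTop (timeOf a N)] with t ht htN
  by_contra! hlt
  have := (ha.timeIndex_spec ht).2
  linarith [ha.strictMono_timeOf.monotone (Nat.succ_le_of_lt hlt)]

theorem IsStepSize.norm_interp_sub_le {d : ℕ} {a : ℕ → ℝ} (ha : IsStepSize a) (x : ℕ → E d)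
    {t : ℝ} (ht : 0 ≤ t) : ‖interp a x t - x (timeIndex a t)‖ ≤
      ‖x (timeIndex a t + 1) - x (timeIndex a t)‖ := by
  obtain ⟨h1, h2⟩ := ha.timeIndex_spec ht
  rw [timeOf_succ] at h2
  have hp := ha.pos (timeIndex a t)
  rw [interp, add_sub_cancel_left, norm_smul]
  refine mul_le_of_le_one_left (norm_nonneg _) ?_
  rw [Real.norm_of_nonneg (div_nonneg (by linarith) hp.le), div_le_one hp]
  linarith

theorem tendsto_interp_nhdsSet {d : ℕ} {a : ℕ → ℝ} (ha : IsStepSize a) {H : Set (E d)}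
    (hH : IsCompact H) {x : ℕ → E d} (hx : ∀ ε > 0, ∀ᶠ n in atTop, x n ∈ Metric.thickening ε H)
    (hinc : Tendsto (fun n => ‖x (n + 1) - x n‖) atTop (𝓝 0)) :
    Tendsto (interp a x) atTop (𝓝ˢ H) := by
  refine (Metric.hasBasis_nhdsSet_thickening hH).tendsto_right_iff.2 fun ε hε => ?_
  filter_upwards [ha.tendsto_timeIndex.eventually (hx (ε / 2) (by positivity)),
    ha.tendsto_timeIndex.eventually (hinc.eventually (gt_mem_nhds (by positivity : 0 < ε / 2))),
    eventually_ge_atTop (0 : ℝ)] with t h1 h2 ht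
  obtain ⟨z, hz, hzd⟩ := Metric.mem_thickening_iff.1 h1
  refine Metric.mem_thickening_iff.2 ⟨z, hz, ?_⟩
  have h3 := ha.norm_interp_sub_le x ht
  rw [← dist_eq_norm] at h3
  linarith [dist_triangle (interp a x t) (x (timeIndex a t)) z]

/-! ### Noise estimates along the stochastic iteration. -/

section

variable {d k : ℕ} {f : E d → E k → E d} {κ : Kernel (E d × E k) (E k)}
  {v : E d → E k → E d} {K K' C : ℝ} {a : ℕ → ℝ} {Ω : Type*} [mΩ : MeasurableSpace Ω]
  {P : Measure Ω} {ℱ : Filtration ℕ mΩ} {θ : ℕ → Ω → E d} {Y : ℕ → Ω → E k} {M : ℕ → Ω → E d}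

theorem IsSA.norm_increment_le (h : IsSA f κ K' C a P ℱ θ Y M) (ha : IsStepSize a)
    (hK : ∀ θ y, ‖f θ y‖ ≤ K * (1 + ‖θ‖)) {R : ℝ} {ω : Ω} {n : ℕ}
    (hM : ‖M (n + 1) ω‖ ≤ K' * (1 + ‖θ n ω‖)) (hθ : ‖θ n ω‖ ≤ R) :
    ‖θ (n + 1) ω - θ n ω‖ ≤ (|K| + |K'|) * (1 + R) * a n := by
  have hR : 0 ≤ R := (norm_nonneg _).trans hθ
  rw [h.recursion, add_sub_cancel_left, norm_smul, Real.norm_of_nonneg (ha.pos n).le, mul_comm]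
  refine mul_le_mul_of_nonneg_right ((norm_add_le _ _).trans ?_) (ha.pos n).le
  have h1 : K * (1 + ‖θ n ω‖) ≤ |K| * (1 + R) :=
    mul_le_mul (le_abs_self K) (by linarith) (by positivity) (abs_nonneg K)
  have h2 : K' * (1 + ‖θ n ω‖) ≤ |K'| * (1 + R) :=
    mul_le_mul (le_abs_self K') (by linarith) (by positivity) (abs_nonneg K')
  linarith [hK (θ n ω) (Y n ω)]

theorem IsSA.norm_sum_noise_le (h : IsSA f κ K' C a P ℱ θ Y M) (ha : IsStepSize a)
    (hK : ∀ θ y, ‖f θ y‖ ≤ K * (1 + ‖θ‖)) {Γ : E d → Measure (E k)}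
    (hv : ∀ θ, IsPoissonSolution (Kernel.sectR κ θ) (Γ θ) (f θ) (v θ))
    {R cv : ℝ} (hcv : 0 < cv) (hR : 0 ≤ R)
    (hgrow : ∀ θ, ‖θ‖ ≤ R → ∀ y, ‖v θ y‖ ≤ cv * (1 + ‖y‖))
    (hlip : ∀ θ θ', ‖θ‖ ≤ R → ‖θ'‖ ≤ R → ∀ y, ‖v θ y - v θ' y‖ ≤ cv * ‖θ - θ'‖ * (1 + ‖y‖))
    {ω : Ω} {n₀ : ℕ} (hY : ∀ n ≥ n₀, ‖Y n ω‖ ≤ C)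
    (hM : ∀ n, ‖M (n + 1) ω‖ ≤ K' * (1 + ‖θ n ω‖)) {η : ℝ}
    (hη : ∀ N, ‖∑ i ∈ Finset.range N, cutNoise κ v θ Y M a R (n₀ + i) ω‖ ≤ η)
    {j n : ℕ} (hj : n₀ ≤ j) (hjn : j ≤ n) (hθ : ∀ m, j ≤ m → m < n → ‖θ m ω‖ ≤ R) :
    ‖∑ m ∈ Finset.Ico j n, (θ (m + 1) ω - θ m ω - a m • meanField f Γ (θ m ω))‖ ≤
      2 * η + cv * (1 + C) * (2 * a n₀ + (|K| + |K'|) * (1 + R) * tailSq a n₀) := by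
  have hC : 0 ≤ C := (norm_nonneg _).trans (hY n₀ le_rfl)
  have hdec : ∑ m ∈ Finset.Ico j n, (θ (m + 1) ω - θ m ω - a m • meanField f Γ (θ m ω)) =
      ∑ m ∈ Finset.Ico j n, cutNoise κ v θ Y M a R m ω +
      ∑ m ∈ Finset.Ico j n, a m • (v (θ m ω) (Y m ω) - v (θ m ω) (Y (m + 1) ω)) := by
    rw [← Finset.sum_add_distrib]
    refine Finset.sum_congr rfl fun m hm => ?_
    rw [Finset.mem_Ico] at hm
    have hp := (hv (θ m ω)).eq (Y m ω)
    rw [Kernel.sectR_apply] at hp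
    have hmem : ω ∈ {ω | ‖θ m ω‖ ≤ R} := hθ m hm.1 hm.2
    rw [cutNoise, indicator_of_mem hmem, martNoise, h.recursion, add_sub_cancel_left, ← smul_sub,
      ← smul_add]
    congr 1
    calc _ = M (m + 1) ω + (f (θ m ω) (Y m ω) - meanField f Γ (θ m ω)) := by abel
      _ = _ := by rw [meanField, ← hp]; abel
  -- A block is a difference of two partial sums started at `n₀`, hence the factor `2` in front of
  -- `η`.
  have hcut : ∑ m ∈ Finset.Ico j n, cutNoise κ v θ Y M a R m ω =
      ∑ i ∈ Finset.range (n - n₀), cutNoise κ v θ Y M a R (n₀ + i) ω -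
      ∑ i ∈ Finset.range (j - n₀), cutNoise κ v θ Y M a R (n₀ + i) ω := by
    rw [← Finset.sum_Ico_eq_sum_range (fun m => cutNoise κ v θ Y M a R m ω),
      ← Finset.sum_Ico_eq_sum_range (fun m => cutNoise κ v θ Y M a R m ω),
      ← Finset.sum_Ico_consecutive _ hj hjn, add_sub_cancel_left]
  have h1 : ‖∑ m ∈ Finset.Ico j n, cutNoise κ v θ Y M a R m ω‖ ≤ 2 * η := by
    rw [hcut]
    refine (norm_sub_le _ _).trans ?_
    linarith [hη (n - n₀), hη (j - n₀)]
  have h2 := norm_sum_poisson_diff_le ha hcv (F := (|K| + |K'|) * (1 + R)) (by positivity) hgrow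
    hlip (θ := fun m => θ m ω) (Y := fun m => Y m ω) (fun m hm => hY m (hj.trans hm)) hθ
    (fun m hm hmn => h.norm_increment_le ha hK (hM m) (hθ m hm hmn))
  rw [hdec]
  refine (norm_add_le _ _).trans (add_le_add h1 (h2.trans ?_))
  have h3 := ha.antitone hj
  have h4 := ha.sum_Ico_le_tailSq (n := n) hj
  gcongr

theorem tendsto_azuma_bound {a : ℕ → ℝ} (ha : IsStepSize a) (d : ℕ) {b : ℝ} (hb : 0 < b) :
    Tendsto (fun n => 2 * d * Real.exp (-(b / tailSq a n))) atTop (𝓝 0) := by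
  have h1 : Tendsto (fun n => (tailSq a n)⁻¹) atTop atTop :=
    tendsto_inv_nhdsGT_zero.comp (tendsto_nhdsWithin_iff.2
      ⟨ha.tendsto_tailSq, Eventually.of_forall fun n => ha.tailSq_pos n⟩)
  have h2 := (Real.tendsto_exp_neg_atTop_nhds_zero.comp
    (h1.const_mul_atTop hb)).const_mul (2 * (d : ℝ))
  rw [mul_zero] at h2
  exact h2

/-- The event that no late starting time has small partial sums lies in the Azuma event for each `n₁
≥ N₀`. Its probability is below bounds that vanish with `tailSq a n₁`, so it is null. -/
theorem IsSA.ae_eventually_cutNoise_le [IsMarkovKernel κ] [IsProbabilityMeasure P] (hd : 0 < d)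
    (h : IsSA f κ K' C a P ℱ θ Y M) (hvreg : LocallyRegular v) (hvm : ∀ θ, Measurable (v θ))
    (ha : IsStepSize a) {R c : ℝ} (hc : 0 < c)
    (hbound : ∀ θ y y' m, ‖θ‖ ≤ R → ‖y‖ ≤ C → ‖y'‖ ≤ C → ‖m‖ ≤ K' * (1 + ‖θ‖) →
      ‖m + (v θ y' - ∫ z, v θ z ∂(κ (θ, y)))‖ ≤ c) :
    ∀ᵐ ω ∂P, ∀ η > 0, ∀ᶠ n₁ in atTop,
      ∀ N, ‖∑ i ∈ Finset.range N, cutNoise κ v θ Y M a R (n₁ + i) ω‖ ≤ η := by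
  obtain ⟨N₀, hN₀⟩ := eventually_atTop.1 h.noise_bound
  have hd' : (0 : ℝ) < d := by exact_mod_cast hd
  have hnull : ∀ q : ℕ, ∀ᵐ ω ∂P, ∃ n₁ ≥ N₀,
      ∀ N, ‖∑ i ∈ Finset.range N, cutNoise κ v θ Y M a R (n₁ + i) ω‖ < 1 / ((q : ℝ) + 1) := by
    intro q
    set η : ℝ := 1 / ((q : ℝ) + 1) with hη
    have hη0 : 0 < η := by positivity
    rw [ae_iff]
    set S : Set Ω := {ω | ¬ ∃ n₁ ≥ N₀,
      ∀ N, ‖∑ i ∈ Finset.range N, cutNoise κ v θ Y M a R (n₁ + i) ω‖ < η} with hS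
    have hle : ∀ n₁ ≥ N₀, P.real S ≤
        2 * d * Real.exp (-(η ^ 2 / (2 * d * c ^ 2) / tailSq a n₁)) := by
      intro n₁ hn₁
      have := h.measureReal_cutNoise_ge_le hd hvreg hvm ha hc hbound (n₀ := n₁)
        (fun n hn => hN₀ n (hn₁.trans hn)) MeasurableSet.univ hη0.le
      rw [probReal_univ, one_mul, ← mul_assoc, ← div_div] at this
      refine (measureReal_mono ?_).trans this
      intro ω hω
      refine ⟨mem_univ _, ?_⟩
      by_contra! hcon
      exact hω ⟨n₁, hn₁, fun N => by
        by_contra! h'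
        exact hcon ⟨N, h'⟩⟩
    have h0 : P.real S ≤ 0 := ge_of_tendsto (tendsto_azuma_bound ha d (by positivity))
      (eventually_atTop.2 ⟨N₀, hle⟩)
    exact (measureReal_eq_zero_iff (measure_ne_top _ _)).1 (le_antisymm h0 measureReal_nonneg)
  filter_upwards [ae_all_iff.2 hnull] with ω hω η hη
  obtain ⟨q, hq⟩ := exists_nat_one_div_lt (half_pos hη)
  obtain ⟨n₁, -, hn₁⟩ := hω q
  filter_upwards [eventually_ge_atTop n₁] with n hn N
  obtain ⟨i, rfl⟩ := Nat.exists_eq_add_of_le hn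
  have e : ∑ m ∈ Finset.range N, cutNoise κ v θ Y M a R (n₁ + i + m) ω =
      ∑ m ∈ Finset.range (i + N), cutNoise κ v θ Y M a R (n₁ + m) ω -
      ∑ m ∈ Finset.range i, cutNoise κ v θ Y M a R (n₁ + m) ω := by
    rw [Finset.sum_range_add, add_sub_cancel_left]
    simp only [add_assoc]
  rw [e]
  refine (norm_sub_le _ _).trans ?_
  linarith [hn₁ (i + N), hn₁ i]

end

/-! ### Convergence on the good event and the lock-in bound. -/

theorem exists_integralCurve_of_attraction {d : ℕ} {h : E d → E d} {L : ℝ≥0}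
    (hL : LipschitzWith L h) {B H : Set (E d)} (hattr : closure B ⊆ domainOfAttraction h H)
    {RB : ℝ} (hRB : ∀ θ ∈ closure B, ‖θ‖ ≤ RB) {A : Set (E d)} {T : ℝ}
    (hT : ∀ x, x 0 ∈ closure B → IsIntegralCurveOn x (fun _ => h) (Ici 0) → ∀ t ≥ T, x t ∈ A) :
    ∀ θ₀ ∈ B, ∃ x : ℝ → E d, x 0 = θ₀ ∧ IsIntegralCurveOn x (fun _ => h) (Ici 0) ∧
      (∀ t ∈ Icc 0 (2 * T + 2), ‖x t‖ ≤ gronwallBound RB L ‖h 0‖ (2 * T + 2)) ∧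
      ∀ t ≥ T, x t ∈ A := by
  intro θ₀ hθ₀
  obtain ⟨x, rfl, hx, -⟩ := hattr (subset_closure hθ₀)
  exact ⟨x, rfl, hx, fun t ht =>
    norm_integralCurve_le hL hx (hRB _ (subset_closure hθ₀)) ht.1 ht.2,
    hT x (subset_closure hθ₀) hx⟩

theorem eventually_trapping_error_lt {a : ℕ → ℝ} (ha : IsStepSize a) {η δ l T b₁ b₂ b₃ e : ℝ}
    (hη : 2 * η * (1 + l * T * e) < δ) :
    ∀ᶠ n in atTop, (2 * η + b₁ * (2 * a n + b₂ * tailSq a n)) +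
      (l * (2 * η + b₁ * (2 * a n + b₂ * tailSq a n)) * T + l * b₃ * tailSq a n) * e < δ := by
  have hc : Continuous fun p : ℝ × ℝ => (2 * η + b₁ * (2 * p.1 + b₂ * p.2)) +
      (l * (2 * η + b₁ * (2 * p.1 + b₂ * p.2)) * T + l * b₃ * p.2) * e := by fun_prop
  have ht := (hc.tendsto (0, 0)).comp (ha.tendsto_zero.prodMk_nhds ha.tendsto_tailSq)
  refine ht.eventually_lt_const (lt_of_eq_of_lt ?_ hη)
  ring

/-- Moving a point of `H` by `δ / 2` stays inside the bounded set `B`. This bounds every admissible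
`δ` and lets the cut-off radius be chosen before `δ`. -/
theorem le_of_thickening_subset {d : ℕ} (hd : 0 < d) {H A B : Set (E d)} (hne : H.Nonempty)
    (hHA : H ⊆ A) (hHB : H ⊆ B) {δ RB : ℝ} (hδ : 0 < δ) (hsub : Metric.thickening δ A ⊆ B)
    (hRB : ∀ θ ∈ B, ‖θ‖ ≤ RB) : δ ≤ 4 * RB := by
  obtain ⟨p, hp⟩ := hne
  set e : E d := EuclideanSpace.single ⟨0, hd⟩ (1 : ℝ) with he
  have hnorm : ‖(δ / 2) • e‖ = δ / 2 := by
    rw [norm_smul, he, PiLp.norm_single, norm_one, mul_one,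
      Real.norm_of_nonneg (by positivity)]
  have hq : p + (δ / 2) • e ∈ B := hsub (Metric.mem_thickening_iff.2 ⟨p, hHA hp, by
    rw [dist_eq_norm, add_sub_cancel_left, hnorm]; linarith⟩)
  have h1 := norm_sub_le (p + (δ / 2) • e) p
  rw [add_sub_cancel_left, hnorm] at h1
  linarith [hRB _ hq, hRB _ (hHB hp)]

theorem one_sub_le_cond_real {Ω : Type*} {mΩ : MeasurableSpace Ω} {P : Measure Ω}
    [IsProbabilityMeasure P] {B S A : Set Ω} (hB : MeasurableSet B) (hPB : P B ≠ 0) {p : ℝ}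
    (hbad : P.real (B ∩ A) ≤ P.real B * p) (hsub : ∀ᵐ ω ∂P, ω ∈ B → ω ∉ A → ω ∈ S) :
    1 - p ≤ (P[|B]).real S := by
  have hB0 : 0 < P.real B := (measureReal_nonneg).lt_of_ne'
    (by rwa [Ne, measureReal_eq_zero_iff (measure_ne_top _ _)])
  have h1 : P B ≤ P (B ∩ S ∪ B ∩ A) := by
    refine measure_mono_ae ?_
    filter_upwards [hsub] with ω hω hωB
    by_cases hA : ω ∈ A
    · exact Or.inr ⟨hωB, hA⟩
    · exact Or.inl ⟨hωB, hω hωB hA⟩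
  have h2 : P.real B ≤ P.real (B ∩ S) + P.real (B ∩ A) :=
    (ENNReal.toReal_mono (measure_ne_top _ _) h1).trans (measureReal_union_le _ _)
  have h3 : (P[|B]).real S = P.real (B ∩ S) / P.real B := by
    rw [measureReal_def, cond_apply hB, ENNReal.toReal_mul, ENNReal.toReal_inv, div_eq_inv_mul]
    rfl
  rw [h3, le_div_iff₀ hB0]
  linarith

/-- The trapping argument is rerun from a late time with `δ` and the target neighbourhood both of
size `r`, as small as desired. This is possible because the iterates are already in `B` and the
remaining noise is arbitrarily small. -/
theorem eventually_mem_thickening_of_noise {d : ℕ} {h : E d → E d} {L : ℝ≥0}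
    (hL : LipschitzWith L h) {G H B : Set (E d)} {V : E d → ℝ} (hV : IsStrictLyapunov h G H V)
    (hne : H.Nonempty) (hBc : IsCompact (closure B)) (hBG : closure B ⊆ G)
    (hattr : closure B ⊆ domainOfAttraction h H) {ε : ℝ} (hε : 0 < ε)
    (hεB : Metric.thickening ε H ⊆ B) {a : ℕ → ℝ} (ha : IsStepSize a) {θ : ℕ → E d}
    (hθB : ∀ᶠ n in atTop, θ n ∈ B)
    (hnoise : ∀ η > 0, ∀ᶠ n₁ in atTop, ∀ j n, n₁ ≤ j → j ≤ n →
      ‖∑ m ∈ Finset.Ico j n, (θ (m + 1) - θ m - a m • h (θ m))‖ ≤ η) :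
    ∀ ε' > 0, ∀ᶠ n in atTop, θ n ∈ Metric.thickening ε' H := by
  intro ε' hε'
  set r := min ε ε' / 2 with hr
  have hr0 : 0 < r := by positivity
  have hsubε : Metric.thickening (r + r) H ⊆ Metric.thickening ε H :=
    Metric.thickening_mono (by rw [hr]; linarith [min_le_left ε ε']) H
  have hsubε' : Metric.thickening (r + r) H ⊆ Metric.thickening ε' H :=
    Metric.thickening_mono (by rw [hr]; linarith [min_le_right ε ε']) H
  have hsub : Metric.thickening r (Metric.thickening r H) ⊆ Metric.thickening (r + r) H :=
    Metric.thickening_thickening_subset r r H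
  obtain ⟨RB, hRB⟩ := hBc.isBounded.exists_norm_le
  obtain ⟨T, hT1, hT⟩ := exists_time_forall_mem_thickening hL hV hne hBc hattr hr0
    ((Metric.thickening_mono (by linarith) H).trans
      (hsubε.trans (hεB.trans (subset_closure.trans hBG))))
  have hflow := exists_integralCurve_of_attraction hL hattr hRB hT
  set Rx := gronwallBound RB L ‖h 0‖ (2 * T + 2)
  set A₀ := 1 + (L : ℝ) * (2 * T + 2) * Real.exp (L * (2 * T + 2)) with hA₀
  have hA₀0 : 0 < A₀ := by positivity
  have hη : 2 * (r / (4 * A₀)) * A₀ < r := by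
    have : 2 * (r / (4 * A₀)) * A₀ = r / 2 := by field_simp; ring
    linarith
  have herr := eventually_trapping_error_lt ha (b₁ := 0) (b₂ := 0) (b₃ := ‖h 0‖ + L * Rx) hη
  obtain ⟨n₁, h1, h2, h3, h4⟩ := (herr.and ((hnoise (2 * (r / (4 * A₀))) (by positivity)).and
    (hθB.and (eventually_forall_ge_atTop.2
      (ha.tendsto_zero.eventually (ge_mem_nhds one_pos)))))).exists
  simp only [zero_mul, add_zero] at h1
  have htrap := fun n hn => (norm_le_and_mem_thickening_of_noise_le hL hT1 hflow
    (hsub.trans (hsubε.trans hεB)) le_rfl ha (n₁ := n₁) h4 h3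
    (fun j n hj hjn _ => h2 j n hj hjn) h1 (n := n) hn).2
  filter_upwards [eventually_ge_atTop n₁,
    ha.tendsto_timeOf.eventually (eventually_ge_atTop (T + timeOf a n₁))] with n hn hTn
  exact hsubε' (hsub (htrap n hn (by linarith)))

theorem IsSA.exists_lock_in_bound {d k : ℕ} (hd : 0 < d)
    {f : E d → E k → E d} {κ : Kernel (E d × E k) (E k)} [IsMarkovKernel κ]
    {Γ : E d → Measure (E k)} {v : E d → E k → E d} {C K K' : ℝ} {L : ℝ≥0}
    (hK : ∀ θ y, ‖f θ y‖ ≤ K * (1 + ‖θ‖)) (hL : LipschitzWith L (meanField f Γ))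
    (hv : ∀ θ, IsPoissonSolution (Kernel.sectR κ θ) (Γ θ) (f θ) (v θ))
    (hvreg : LocallyRegular v) {G H B : Set (E d)} {V : E d → ℝ}
    (hV : IsStrictLyapunov (meanField f Γ) G H V) (hne : H.Nonempty)
    (hB : IsOpen B) (hBc : IsCompact (closure B)) (hHB : H ⊆ B) (hBG : closure B ⊆ G)
    (hattr : closure B ⊆ domainOfAttraction (meanField f Γ) H)
    {ε₁ ε : ℝ} (hε₁ : 0 < ε₁) (hε : ε₁ < ε) (hεB : Metric.thickening ε H ⊆ B) :
    ∃ Khat > 0, ∀ δ > 0,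
      Metric.thickening δ (Metric.thickening ε₁ H) ⊆ Metric.thickening ε H →
      ∀ a : ℕ → ℝ, IsStepSize a →
      ∀ (Ω : Type*) [mΩ : MeasurableSpace Ω] (P : Measure Ω) [IsProbabilityMeasure P]
        (ℱ : Filtration ℕ mΩ) (θ : ℕ → Ω → E d) (Y : ℕ → Ω → E k) (M : ℕ → Ω → E d),
        IsSA f κ K' C a P ℱ θ Y M →
        ∀ᶠ n₀ in atTop, P {ω | θ n₀ ω ∈ B} ≠ 0 →
          1 - 2 * d * Real.exp (-(Khat * δ ^ 2 / (d * tailSq a n₀)))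
            ≤ (P[|{ω | θ n₀ ω ∈ B}]).real
                {ω | Tendsto (interp a fun n => θ n ω) atTop (𝓝ˢ H)} := by
  have hd' : (0 : ℝ) < d := by exact_mod_cast hd
  set h := meanField f Γ with hh
  obtain ⟨RB, hRB⟩ := hBc.isBounded.exists_norm_le
  have hRB0 : 0 ≤ RB := by
    obtain ⟨p, hp⟩ := hne
    exact (norm_nonneg p).trans (hRB p (subset_closure (hHB hp)))
  obtain ⟨T, hT1, hT⟩ := exists_time_forall_mem_thickening hL hV hne hBc hattr hε₁
    ((Metric.thickening_mono hε.le H).trans (hεB.trans (subset_closure.trans hBG)))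
  have hflow := exists_integralCurve_of_attraction hL hattr hRB hT
  set Rx := gronwallBound RB L ‖h 0‖ (2 * T + 2)
  -- `4 * RB` dominates every admissible `δ`, so `R`, and with it `c` and the final constant, does
  -- not depend on `δ`.
  set R := |Rx| + 4 * RB + 1 with hR
  have hR0 : 0 < R := by positivity
  obtain ⟨c, hc, hcb⟩ := exists_norm_martNoise_le hK hL hv hvreg R C K'
  obtain ⟨cv, hcv, hgrow, hlip⟩ := hvreg R hR0
  set A₀ := 1 + (L : ℝ) * (2 * T + 2) * Real.exp (L * (2 * T + 2)) with hA₀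
  have hA₀0 : 0 < A₀ := by positivity
  -- `A₀` is the Gronwall amplification of the noise. With `η = δ / (4 * A₀)`, noise of size `2 * η`
  -- moves the iterates by at most `δ / 2`; the rest of `δ` absorbs the terms vanishing with `n₀`.
  -- The constant is the one in the Azuma exponent for this `η`.
  refine ⟨(1 / (4 * A₀)) ^ 2 / (2 * c ^ 2), by positivity, ?_⟩
  intro δ hδ hδsub a ha Ω mΩ P _ ℱ θ Y M hSA
  set η := δ / (4 * A₀) with hη
  have hη0 : 0 < η := by positivity
  have hηlt : 2 * η * A₀ < δ := by
    have : 2 * η * A₀ = δ / 2 := by rw [hη]; field_simp; ring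
    linarith
  have hδR : Rx + δ ≤ R := by
    have := le_of_thickening_subset hd hne (Metric.self_subset_thickening hε₁ H)
      (Metric.self_subset_thickening (hε₁.trans hε) H) hδ hδsub
      (fun θ hθ => hRB θ (subset_closure (hεB hθ)))
    linarith [le_abs_self Rx]
  set q : ℕ → ℝ := fun n =>
    cv * (1 + C) * (2 * a n + (|K| + |K'|) * (1 + R) * tailSq a n) with hq
  have hq0 : Tendsto q atTop (𝓝 0) := by
    have := ((ha.tendsto_zero.const_mul 2).add
      (ha.tendsto_tailSq.const_mul ((|K| + |K'|) * (1 + R)))).const_mul (cv * (1 + C))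
    simpa using this
  have hvm : ∀ θ, Measurable (v θ) := fun θ => (hv θ).measurable
  obtain ⟨N₀, hN₀⟩ := eventually_atTop.1 hSA.noise_bound
  filter_upwards [eventually_ge_atTop N₀,
    eventually_forall_ge_atTop.2 (ha.tendsto_zero.eventually (ge_mem_nhds one_pos)),
    eventually_trapping_error_lt ha (b₁ := cv * (1 + C)) (b₂ := (|K| + |K'|) * (1 + R))
      (b₃ := ‖h 0‖ + L * Rx) hηlt] with n₀ hn₀ ha1 herr hPB
  have hBm : MeasurableSet[ℱ n₀] {ω | θ n₀ ω ∈ B} := hSA.measurable_iterate n₀ hB.measurableSet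
  have haz := hSA.measureReal_cutNoise_ge_le hd hvreg hvm ha hc hcb (n₀ := n₀)
    (fun n hn => hN₀ n (hn₀.trans hn)) hBm hη0.le
  have hexp : η ^ 2 / (2 * d * (c ^ 2 * tailSq a n₀)) =
      (1 / (4 * A₀)) ^ 2 / (2 * c ^ 2) * δ ^ 2 / (d * tailSq a n₀) := by
    have := ha.tailSq_pos n₀
    rw [hη]; field_simp
  rw [hexp] at haz
  refine one_sub_le_cond_real (ℱ.le _ _ hBm) hPB haz ?_
  have hYae : ∀ᵐ ω ∂P, ∀ n, n₀ ≤ n → ‖Y n ω‖ ≤ C := ae_all_iff.2 fun n => by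
    by_cases hn : n₀ ≤ n
    · exact (hN₀ n (hn₀.trans hn)).mono fun ω hω _ => hω
    · exact Eventually.of_forall fun ω hn' => absurd hn' hn
  filter_upwards [hYae, ae_all_iff.2 hSA.mart_bound,
    hSA.ae_eventually_cutNoise_le hd hvreg hvm ha hc hcb] with ω hY hM hcauchy hωB hgood
  have hgood' : ∀ N, ‖∑ i ∈ Finset.range N, cutNoise κ v θ Y M a R (n₀ + i) ω‖ ≤ η := by
    intro N
    by_contra! hlt
    exact hgood ⟨N, hlt.le⟩
  have htrap := fun n (hn : n₀ ≤ n) => norm_le_and_mem_thickening_of_noise_le hL hT1 hflow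
    (hδsub.trans hεB) hδR ha ha1 (θ := fun n => θ n ω) hωB
    (fun j n hj hjn hb => hSA.norm_sum_noise_le ha hK hv hcv hR0.le hgrow hlip hY hM hgood'
      hj hjn hb) herr hn
  have hθB : ∀ᶠ n in atTop, θ n ω ∈ B := by
    filter_upwards [eventually_ge_atTop n₀,
      ha.tendsto_timeOf.eventually (eventually_ge_atTop (T + timeOf a n₀))] with n hn hTn
    exact hεB (hδsub ((htrap n hn).2 (by linarith)))
  refine tendsto_interp_nhdsSet ha hV.isCompact ?_ ?_
  · refine eventually_mem_thickening_of_noise hL hV hne hBc hBG hattr (hε₁.trans hε) hεB ha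
      hθB fun η' hη' => ?_
    -- The budget is `2 * (η' / 4)` for the martingale part and `η' / 2` for the Poisson correction
    -- `q`.
    filter_upwards [hcauchy (η' / 4) (by positivity), eventually_ge_atTop n₀,
      hq0.eventually (ge_mem_nhds (half_pos hη'))] with n₁ hcut hn₁ hqn j n hj hjn
    have := hSA.norm_sum_noise_le ha hK hv hcv hR0.le hgrow hlip
      (fun n hn => hY n (hn₁.trans hn)) hM hcut hj hjn
      (fun m hm _ => (htrap m (hn₁.trans (hj.trans hm))).1)
    linarith
  · have hlim := ha.tendsto_zero.const_mul ((|K| + |K'|) * (1 + R))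
    rw [mul_zero] at hlim
    refine squeeze_zero' (Eventually.of_forall fun _ => norm_nonneg _) ?_ hlim
    filter_upwards [eventually_ge_atTop n₀] with n hn
    exact hSA.norm_increment_le ha hK (hM n) (htrap n hn).1

end LockIn

theorem mainTheorem3 {d k : ℕ}
    (f : LockIn.E d → LockIn.E k → LockIn.E d) (hf : Measurable (Function.uncurry f))
    (κ : Kernel (LockIn.E d × LockIn.E k) (LockIn.E k)) [IsMarkovKernel κ]
    (Γ : LockIn.E d → Measure (LockIn.E k))
    (v : LockIn.E d → LockIn.E k → LockIn.E d)
    (C K K' : ℝ) (L : ℝ≥0)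
    (hK : ∀ θ y, ‖f θ y‖ ≤ K * (1 + ‖θ‖))
    (hΓ : ∀ θ, LockIn.IsUniqueInvariantProb (Kernel.sectR κ θ) (Γ θ))
    (hL : LipschitzWith L (LockIn.meanField f Γ))
    (hv : ∀ θ, LockIn.IsPoissonSolution (Kernel.sectR κ θ) (Γ θ) (f θ) (v θ))
    (hvreg : LockIn.LocallyRegular v)
    (G H B : Set (LockIn.E d)) (V : LockIn.E d → ℝ)
    (hV : LockIn.IsStrictLyapunov (LockIn.meanField f Γ) G H V)
    (hB : IsOpen B) (hBc : IsCompact (closure B)) (hHB : H ⊆ B) (hBG : closure B ⊆ G)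
    (hattr : closure B ⊆ LockIn.domainOfAttraction (LockIn.meanField f Γ) H)
    (ε₁ ε : ℝ) (hε₁ : 0 < ε₁) (hε : ε₁ < ε) (hεB : Metric.thickening ε H ⊆ B) :
    ∃ Khat > 0, ∃ Chat > 0, ∀ δ > 0,
      Metric.thickening δ (Metric.thickening ε₁ H) ⊆ Metric.thickening ε H →
      ∀ a : ℕ → ℝ, LockIn.IsStepSize a →
      ∀ (Ω : Type*) [mΩ : MeasurableSpace Ω] (P : Measure Ω) [IsProbabilityMeasure P]
        (ℱ : Filtration ℕ mΩ) (θ : ℕ → Ω → LockIn.E d) (Y : ℕ → Ω → LockIn.E k)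
        (M : ℕ → Ω → LockIn.E d),
        LockIn.IsSA f κ K' C a P ℱ θ Y M →
        ∀ᶠ n₀ in atTop, P {ω | θ n₀ ω ∈ B} ≠ 0 →
          1 - 2 * d * Real.exp (-(Khat * δ ^ 2 / (d * LockIn.tailSq a n₀)))
              - 2 * d * Real.exp (-(Chat * δ ^ 2 / (d * LockIn.tailSq a n₀)))
            ≤ (P[|{ω | θ n₀ ω ∈ B}]).real
                {ω | Tendsto (LockIn.interp a fun n => θ n ω) atTop (𝓝ˢ H)} := by
  rcases H.eq_empty_or_nonempty with rfl | hne
  · refine ⟨1, one_pos, 1, one_pos, fun δ _ _ a _ Ω _ P _ ℱ θ Y M _ =>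
      Eventually.of_forall fun n₀ hPB => absurd ?_ hPB⟩
    -- Nothing converges to the empty set, whose neighbourhood filter is trivial; so `B` is empty
    -- and the conditioning event is null.
    have hBe : B = ∅ := by
      refine eq_empty_of_forall_notMem fun p hp => ?_
      obtain ⟨x, -, -, hx⟩ := hattr (subset_closure hp)
      rw [nhdsSet_empty] at hx
      exact (map_neBot (m := x) (f := atTop)).ne (le_bot_iff.1 hx)
    simp [hBe]
  rcases Nat.eq_zero_or_pos d with rfl | hd
  · refine ⟨1, one_pos, 1, one_pos, fun δ _ _ a _ Ω _ P _ ℱ θ Y M _ =>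
      Eventually.of_forall fun n₀ hPB => ?_⟩
    have huniv : H = univ := Subsingleton.eq_univ_of_nonempty hne
    have := cond_isProbabilityMeasure hPB
    simp [huniv]
  · obtain ⟨Khat, hKhat, hbound⟩ := LockIn.IsSA.exists_lock_in_bound (C := C) (K' := K') hd hK hL
      hv hvreg hV hne hB hBc hHB hBG hattr hε₁ hε hεB
    refine ⟨Khat, hKhat, Khat, hKhat, fun δ hδ hδsub a ha Ω _ P _ ℱ θ Y M hSA => ?_⟩
    filter_upwards [hbound δ hδ hδsub a ha Ω P ℱ θ Y M hSA] with n₀ hn₀ hPB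
    refine le_trans (sub_le_self _ ?_) (hn₀ hPB)
    positivity
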